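/- Theorem (discounted LQR Bellman equation). Let $A\in\mathbb R^{n\times n}$, $B\in\mathbb R^{n\times m}$, $Q\in\mathbb R^{n\times n}$ symmetric with $Q\succeq 0$, $R\in\mathbb R^{m\times m}$ symmetric with $R\succ 0$, and $\gamma\in(0,1)$. Put $\ell(x,u)=\tfrac12(x^\top Qx+u^\top Ru)$. Let $x_0$ be a square-integrable random vector in $\mathbb R^n$ with mean $\mu_0$ and covariance matrix $\Sigma_0$, and let $w_0,w_1,\dots$ be i.i.d. square-integrable random vectors in $\mathbb R^n$, with $(w_k)_{k\ge0}$ independent of $x_0$, $\mathbb E[w_k]=0$ and $\mathbb E[w_kw_k^\top]=\Sigma_w$. A policy is a sequence $\pi=(\pi_0,\pi_1,\dots)$ of measurable maps $\pi_k:\mathbb R^n\to\mathbb R^m$; under $\pi$ the system evolves by $x_{k+1}=Ax_k+Bu_k+w_k$ with $u_k=\pi_k(x_k)$. Let $$J(\pi)=\mathbb E\Big[\sum_{k=0}^\infty\gamma^k\ell(x_k,u_k)\Big]\in[0,\infty],$$ let $V^\pi(x)\in[0,\infty]$ be the same expectation for the system started at the deterministic state $x_0=x$, and let $V^*(x)=\inf_\pi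 V^\pi(x)$. Assume that $(A,B)$ is stabilizable (there is $K$ such that all eigenvalues of $A+BK$ have modulus less than $1$) and that $(A,Q^{1/2})$ is detectable (there is $L$ such that all eigenvalues of $A+LQ^{1/2}$ have modulus less than $1$), where $Q^{1/2}$ is the positive semidefinite square root of $Q$. Then: 1. $V^*$ satisfies the Bellman equation $$V^*(x)=\inf_{u\in\mathbb R^m}\big\{\ell(x,u)+\gamma\,\mathbb E[V^*(Ax+Bu+w_0)]\big\}\qquad\text{for all }x\in\mathbb R^n.$$ 2. With $A_\gamma=\sqrt\gamma\,A$ and $R_\gamma=\tfrac1\gamma R$, the Riccati equation $$A_\gamma^\top PA_\gamma-P+Q-A_\gamma^\top PB(B^\top PB+R_\gamma)^{-1}B^\top PA_\gamma=0$$ has exactly one symmetric positive semidefinite solution $P$, and $$V^*(x)=\tfrac12\Big(x^\top Px+\tfrac{\gamma}{1-\gamma}\operatorname{tr}(P\Sigma_w)\Big)\qquad\text{for all }x\in\mathbb R^n.$$ 3. Let $F=-(R+\gamma B^\top PB)^{-1}\gamma B^\top PA$, $\pi_F(x)=Fx$ and $\pi^*=(\pi_F,\pi_F,\dots)$. Then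 $J(\pi^*)=\inf_\pi J(\pi)=\mathbb E[V^*(x_0)]$. Moreover $V^{\pi^*}(x)=V^*(x)$ for all $x$, and $\pi^*$ is the only time-invariant policy with this property: for measurable $\varphi:\mathbb R^n\to\mathbb R^m$, $V^{(\varphi,\varphi,\dots)}=V^*$ on $\mathbb R^n$ if and only if $\varphi=\pi_F$. -/

import Mathlib

open MeasureTheory ProbabilityTheory
open scoped ENNReal Matrix MatrixOrder

noncomputable section

namespace DiscountedLQR

/-! Controlled Markov systems `x_{k+1} = f (x_k, u_k, w_k)` with discounted cost. -/

/-- A memoryless policy: a sequence of measurable maps from states to actions. -/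
structure Policy (X U : Type*) [MeasurableSpace X] [MeasurableSpace U] where
  act : ℕ → X → U
  measurable_act : ∀ k, Measurable (act k)

/-- The time-invariant policy `(φ, φ, …)`. -/
def Policy.stationary {X U : Type*} [MeasurableSpace X] [MeasurableSpace U]
    (φ : X → U) (hφ : Measurable φ) : Policy X U :=
  ⟨fun _ => φ, fun _ => hφ⟩

/-- The state trajectory under the policy `π`, from the initial state `x₀`, for a given
realization `w` of the disturbances: `x_{k+1} = f (x_k, π_k x_k, w_k)`. -/
def trajectory {X U W : Type*} [MeasurableSpace X] [MeasurableSpace U]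
    (f : X → U → W → X) (π : Policy X U) (x₀ : X) (w : ℕ → W) : ℕ → X
  | 0 => x₀
  | k + 1 => f (trajectory f π x₀ w k) (π.act k (trajectory f π x₀ w k)) (w k)

/-- The discounted cost `∑ₖ γᵏ ℓ (x_k, u_k)`, `u_k = π_k x_k`, of one realization. The stage cost
`ℓ` is meant to be nonnegative, so that the sum always exists in `[0, ∞]`. -/
def pathCost {X U W : Type*} [MeasurableSpace X] [MeasurableSpace U]
    (f : X → U → W → X) (ℓ : X → U → ℝ) (γ : ℝ) (π : Policy X U) (x₀ : X) (w : ℕ → W) : ℝ≥0∞ :=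
  ∑' k, ENNReal.ofReal
    (γ ^ k * ℓ (trajectory f π x₀ w k) (π.act k (trajectory f π x₀ w k)))

/-- `J(π)`: the expected discounted cost of `π` from the random initial state `x₀`. -/
def cost {Ω X U W : Type*} [MeasurableSpace Ω] [MeasurableSpace X] [MeasurableSpace U]
    (Pr : Measure Ω) (f : X → U → W → X) (ℓ : X → U → ℝ) (γ : ℝ)
    (x₀ : Ω → X) (w : ℕ → Ω → W) (π : Policy X U) : ℝ≥0∞ :=
  ∫⁻ ω, pathCost f ℓ γ π (x₀ ω) (fun k => w k ω) ∂Pr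

/-- `V^π(x)`: the expected discounted cost of `π` when the system starts at `x`. -/
def value {Ω X U W : Type*} [MeasurableSpace Ω] [MeasurableSpace X] [MeasurableSpace U]
    (Pr : Measure Ω) (f : X → U → W → X) (ℓ : X → U → ℝ) (γ : ℝ)
    (w : ℕ → Ω → W) (π : Policy X U) (x : X) : ℝ≥0∞ :=
  ∫⁻ ω, pathCost f ℓ γ π x (fun k => w k ω) ∂Pr

/-- `V*(x) = inf_π V^π(x)`. -/
def optimalValue {Ω X U W : Type*} [MeasurableSpace Ω] [MeasurableSpace X] [MeasurableSpace U]
    (Pr : Measure Ω) (f : X → U → W → X) (ℓ : X → U → ℝ) (γ : ℝ)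
    (w : ℕ → Ω → W) (x : X) : ℝ≥0∞ :=
  ⨅ π : Policy X U, value Pr f ℓ γ w π x

/-- `V` satisfies the Bellman equation
`V(x) = inf_u {ℓ(x, u) + γ E[V(x₁) | x₀ = x, u₀ = u]}`, where `x₁ = f (x, u, w₀)`. -/
def SatisfiesBellman {Ω X U W : Type*} [MeasurableSpace Ω]
    (Pr : Measure Ω) (f : X → U → W → X) (ℓ : X → U → ℝ) (γ : ℝ)
    (w : ℕ → Ω → W) (V : X → ℝ≥0∞) : Prop :=
  ∀ x, V x = ⨅ u : U, (ENNReal.ofReal (ℓ x u) + ENNReal.ofReal γ * ∫⁻ ω, V (f x u (w 0 ω)) ∂Pr)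

/-! The linear-quadratic case. -/

/-- The linear dynamics `f (x, u, w) = A x + B u + w`. -/
def linearDynamics {n m : ℕ} (A : Matrix (Fin n) (Fin n) ℝ) (B : Matrix (Fin n) (Fin m) ℝ)
    (x : Fin n → ℝ) (u : Fin m → ℝ) (w : Fin n → ℝ) : Fin n → ℝ :=
  A *ᵥ x + B *ᵥ u + w

/-- The quadratic stage cost `ℓ (x, u) = ½ (xᵀ Q x + uᵀ R u)`. -/
def quadraticCost {n m : ℕ} (Q : Matrix (Fin n) (Fin n) ℝ) (R : Matrix (Fin m) (Fin m) ℝ)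
    (x : Fin n → ℝ) (u : Fin m → ℝ) : ℝ :=
  (1 / 2) * (x ⬝ᵥ Q *ᵥ x + u ⬝ᵥ R *ᵥ u)

/-- A real square matrix is Schur if all its complex eigenvalues lie in the open unit disc. -/
def IsSchur {n : ℕ} (M : Matrix (Fin n) (Fin n) ℝ) : Prop :=
  ∀ z ∈ spectrum ℂ (M.map Complex.ofReal), ‖z‖ < 1

/-- Discrete-time stabilizability of `(A, B)`. -/
def IsStabilizable {n m : ℕ} (A : Matrix (Fin n) (Fin n) ℝ) (B : Matrix (Fin n) (Fin m) ℝ) :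
    Prop :=
  ∃ K : Matrix (Fin m) (Fin n) ℝ, IsSchur (A + B * K)

/-- Discrete-time detectability of `(A, C)`. -/
def IsDetectable {n p : ℕ} (A : Matrix (Fin n) (Fin n) ℝ) (C : Matrix (Fin p) (Fin n) ℝ) :
    Prop :=
  ∃ L : Matrix (Fin n) (Fin p) ℝ, IsSchur (A + L * C)

/-- `P` solves the discounted algebraic Riccati equation, written with `A_γ = √γ A` and
`R_γ = γ⁻¹ R`. -/
def SolvesRiccati {n m : ℕ} (A : Matrix (Fin n) (Fin n) ℝ) (B : Matrix (Fin n) (Fin m) ℝ)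
    (Q : Matrix (Fin n) (Fin n) ℝ) (R : Matrix (Fin m) (Fin m) ℝ) (γ : ℝ)
    (P : Matrix (Fin n) (Fin n) ℝ) : Prop :=
  let Aγ := Real.sqrt γ • A
  let Rγ := (1 / γ) • R
  Aγᵀ * P * Aγ - P + Q - Aγᵀ * P * B * (Bᵀ * P * B + Rγ)⁻¹ * Bᵀ * P * Aγ = 0

/-- The gain `F = -(R + γ Bᵀ P B)⁻¹ γ Bᵀ P A`. -/
def optimalGain {n m : ℕ} (A : Matrix (Fin n) (Fin n) ℝ) (B : Matrix (Fin n) (Fin m) ℝ)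
    (R : Matrix (Fin m) (Fin m) ℝ) (γ : ℝ) (P : Matrix (Fin n) (Fin n) ℝ) :
    Matrix (Fin m) (Fin n) ℝ :=
  -((R + γ • (Bᵀ * P * B))⁻¹ * (γ • (Bᵀ * P * A)))

/-- The function `½ (xᵀ P x + γ / (1 - γ) · tr (P Σ))`. -/
def quadraticValue {n : ℕ} (γ : ℝ) (P S : Matrix (Fin n) (Fin n) ℝ) (x : Fin n → ℝ) : ℝ :=
  (1 / 2) * (x ⬝ᵥ P *ᵥ x + γ / (1 - γ) * (P * S).trace)

theorem measurable_mulVec {n m : ℕ} (F : Matrix (Fin m) (Fin n) ℝ) :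
    Measurable (fun x : Fin n → ℝ => F *ᵥ x) :=
  (Continuous.matrix_mulVec continuous_const continuous_id).measurable

/-- The time-invariant linear policy `u = F x`. -/
def linearPolicy {n m : ℕ} (F : Matrix (Fin m) (Fin n) ℝ) : Policy (Fin n → ℝ) (Fin m → ℝ) :=
  Policy.stationary (fun x => F *ᵥ x) (measurable_mulVec F)

end DiscountedLQR

end

open DiscountedLQR

/-! For positive semidefinite `P` the matrix `R + γBᵀPB` is positive definite, and completing the
square in `u` (`quadForm_step`) writes the one-step cost with terminal form `P` as the form of
`riccatiMap P` at `x` plus the `R + γBᵀPB`-square of `u - Fx`. Everything rests on this identity.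
Centred noise only adds a trace constant (`quadratic_bellman_step`).

The Riccati equation says that `P` is a fixed point of `riccatiMap`. Existence: value iteration from
`0` increases, and the discounted cost of a stabilizing feedback bounds it, so it converges
(`exists_tendsto_riccatiIter`). Uniqueness: for two solutions, run the noise-free system with the
optimal gain of one. Its total cost is finite, so detectability forces `γ^{k/2} x_k → 0`
(`tendsto_discounted_state`); the terminal term of the other solution disappears, and the two forms
compare (`quadForm_le_of_riccati`).

For the stochastic problem, independence allows conditioning on the first disturbance. By induction
every policy costs at least the `N`-step quadratic value over `N` steps (`ofReal_le_partialValue`);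
letting `N → ∞` bounds `V^π` below by the quadratic value. The policy `Fx` never exceeds that value
over any horizon (`value_linearPolicy_le`). Hence the two agree, and `V*` is quadratic. The Bellman
equation and the uniqueness of the stationary policy are then read off from the square. Since one
policy is optimal from all states at once, integrating over `x₀` gives the claim on `J`. -/

namespace DiscountedLQR

open Filter Topology

/-! ### Quadratic forms of real matrices. -/

section QuadraticForms

variable {n m : ℕ}

/-- The quadratic form `xᵀ P x`. -/
def quadForm (P : Matrix (Fin n) (Fin n) ℝ) (x : Fin n → ℝ) : ℝ := x ⬝ᵥ P *ᵥ x

theorem quadForm_nonneg {P : Matrix (Fin n) (Fin n) ℝ} (hP : P.PosSemidef) (x : Fin n → ℝ) :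
    0 ≤ quadForm P x := by
  simpa [quadForm] using hP.dotProduct_mulVec_nonneg x

theorem quadForm_eq_zero {P : Matrix (Fin n) (Fin n) ℝ} (hP : P.PosDef) {x : Fin n → ℝ}
    (h : quadForm P x = 0) : x = 0 := by
  by_contra hx
  have := hP.dotProduct_mulVec_pos hx
  simp only [star_trivial] at this
  exact absurd h this.ne'

theorem quadForm_add (P : Matrix (Fin n) (Fin n) ℝ) (hP : Pᵀ = P) (x y : Fin n → ℝ) :
    quadForm P (x + y) = quadForm P x + 2 * (y ⬝ᵥ P *ᵥ x) + quadForm P y := by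
  have h : x ⬝ᵥ P *ᵥ y = y ⬝ᵥ P *ᵥ x := by
    rw [Matrix.dotProduct_mulVec, ← Matrix.mulVec_transpose, hP, dotProduct_comm]
  simp only [quadForm, Matrix.mulVec_add, add_dotProduct, dotProduct_add, h]
  ring

theorem quadForm_smul (P : Matrix (Fin n) (Fin n) ℝ) (a : ℝ) (x : Fin n → ℝ) :
    quadForm P (a • x) = a ^ 2 * quadForm P x := by
  simp only [quadForm, Matrix.mulVec_smul, smul_dotProduct, dotProduct_smul, smul_eq_mul]
  ring

theorem quadForm_mulVec (P : Matrix (Fin n) (Fin n) ℝ) (M : Matrix (Fin n) (Fin m) ℝ)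
    (x : Fin m → ℝ) : quadForm P (M *ᵥ x) = quadForm (Mᵀ * P * M) x := by
  simp only [quadForm, ← Matrix.mulVec_mulVec, Matrix.dotProduct_mulVec, Matrix.vecMul_transpose]

theorem quadForm_add_matrix (P P' : Matrix (Fin n) (Fin n) ℝ) (x : Fin n → ℝ) :
    quadForm (P + P') x = quadForm P x + quadForm P' x := by
  simp [quadForm, Matrix.add_mulVec]

theorem quadForm_sub_matrix (P P' : Matrix (Fin n) (Fin n) ℝ) (x : Fin n → ℝ) :
    quadForm (P - P') x = quadForm P x - quadForm P' x := by
  simp [quadForm, Matrix.sub_mulVec]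

theorem quadForm_smul_matrix (c : ℝ) (P : Matrix (Fin n) (Fin n) ℝ) (x : Fin n → ℝ) :
    quadForm (c • P) x = c * quadForm P x := by
  simp [quadForm, Matrix.smul_mulVec]

theorem dotProduct_mulVec_single (P : Matrix (Fin n) (Fin n) ℝ) (i j : Fin n) :
    Pi.single i 1 ⬝ᵥ P *ᵥ Pi.single j 1 = P i j := by
  simp

/-- Polarization: the entries of a symmetric matrix from its quadratic form. -/
theorem apply_eq_quadForm {P : Matrix (Fin n) (Fin n) ℝ} (hP : Pᵀ = P) (i j : Fin n) :
    P i j = (quadForm P (Pi.single i 1 + Pi.single j 1) - quadForm P (Pi.single i 1)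
      - quadForm P (Pi.single j 1)) / 2 := by
  rw [quadForm_add P hP, dotProduct_mulVec_single]
  have : P j i = P i j := congrFun (congrFun hP i) j
  rw [this]; ring

theorem eq_of_quadForm_eq {P P' : Matrix (Fin n) (Fin n) ℝ} (hP : Pᵀ = P) (hP' : P'ᵀ = P')
    (h : ∀ x, quadForm P x = quadForm P' x) : P = P' := by
  ext i j
  rw [apply_eq_quadForm hP, apply_eq_quadForm hP', h, h, h]

theorem transpose_eq_of_posSemidef {P : Matrix (Fin n) (Fin n) ℝ} (hP : P.PosSemidef) :
    Pᵀ = P := by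
  have := hP.isHermitian.eq
  rwa [Matrix.conjTranspose_eq_transpose_of_trivial] at this

theorem posSemidef_of_quadForm {P : Matrix (Fin n) (Fin n) ℝ} (hP : Pᵀ = P)
    (h : ∀ x, 0 ≤ quadForm P x) : P.PosSemidef := by
  refine Matrix.PosSemidef.of_dotProduct_mulVec_nonneg ?_ fun x => by simpa [quadForm] using h x
  rw [Matrix.IsHermitian, Matrix.conjTranspose_eq_transpose_of_trivial, hP]

theorem continuous_quadForm (P : Matrix (Fin n) (Fin n) ℝ) : Continuous (quadForm P) := by
  unfold quadForm
  fun_prop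

theorem continuous_quadForm_left (x : Fin n → ℝ) :
    Continuous fun P : Matrix (Fin n) (Fin n) ℝ => quadForm P x := by
  unfold quadForm
  fun_prop

theorem quadForm_zero_right (P : Matrix (Fin n) (Fin n) ℝ) : quadForm P 0 = 0 := by
  simp [quadForm]

theorem quadForm_le_norm (P : Matrix (Fin n) (Fin n) ℝ) (x : Fin n → ℝ) :
    quadForm P x ≤ (∑ i, ∑ j, |P i j|) * ‖x‖ ^ 2 := by
  simp only [quadForm, dotProduct, Matrix.mulVec, Finset.mul_sum, Finset.sum_mul]
  refine Finset.sum_le_sum fun i _ => Finset.sum_le_sum fun j _ => ?_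
  have hi := norm_le_pi_norm x i
  have hj := norm_le_pi_norm x j
  calc x i * (P i j * x j) ≤ |x i * (P i j * x j)| := le_abs_self _
    _ = |P i j| * (|x i| * |x j|) := by simp only [abs_mul]; ring
    _ ≤ |P i j| * (‖x‖ * ‖x‖) := by
        rw [Real.norm_eq_abs] at hi hj
        gcongr
    _ = _ := by ring

theorem quadForm_eq_sqrt_dotProduct {P : Matrix (Fin n) (Fin n) ℝ} (hP : P.PosSemidef)
    (x : Fin n → ℝ) : quadForm P x = (CFC.sqrt P *ᵥ x) ⬝ᵥ (CFC.sqrt P *ᵥ x) := by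
  have h0 : (0 : Matrix (Fin n) (Fin n) ℝ) ≤ P := hP.nonneg
  have hs : (CFC.sqrt P).PosSemidef := Matrix.nonneg_iff_posSemidef.mp (CFC.sqrt_nonneg P)
  have h1 := CFC.sqrt_mul_sqrt_self P h0
  conv_lhs => rw [quadForm, ← h1]
  rw [← Matrix.mulVec_mulVec, Matrix.dotProduct_mulVec, ← Matrix.mulVec_transpose,
    transpose_eq_of_posSemidef hs]

/-- If the quadratic forms `xₖᵀ P xₖ` tend to zero, then so do the vectors `P^{1/2} xₖ`. -/
theorem tendsto_sqrt_mulVec {P : Matrix (Fin n) (Fin n) ℝ} (hP : P.PosSemidef)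
    {x : ℕ → Fin n → ℝ} (h : Tendsto (fun k => quadForm P (x k)) atTop (𝓝 0)) :
    Tendsto (fun k => CFC.sqrt P *ᵥ x k) atTop (𝓝 0) := by
  rw [tendsto_pi_nhds]
  intro i
  have h2 : Tendsto (fun k => Real.sqrt (quadForm P (x k))) atTop (𝓝 0) := by
    simpa [Function.comp_def] using (Real.continuous_sqrt.tendsto 0).comp h
  refine squeeze_zero_norm (fun k => ?_) h2
  rw [Real.norm_eq_abs]
  refine Real.abs_le_sqrt ?_
  rw [quadForm_eq_sqrt_dotProduct hP, dotProduct, sq]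
  exact Finset.single_le_sum
    (f := fun j => (CFC.sqrt P *ᵥ x k) j * (CFC.sqrt P *ᵥ x k) j)
    (fun j _ => mul_self_nonneg _) (Finset.mem_univ i)

/-- `P⁻¹ P^{1/2}` is a left inverse of `P^{1/2}`, so the convergence of `P^{1/2} xₖ` passes to `xₖ`.
-/
theorem tendsto_zero_of_quadForm {P : Matrix (Fin n) (Fin n) ℝ} (hP : P.PosDef)
    {x : ℕ → Fin n → ℝ} (h : Tendsto (fun k => quadForm P (x k)) atTop (𝓝 0)) :
    Tendsto x atTop (𝓝 0) := by
  have h1 := CFC.sqrt_mul_sqrt_self P hP.posSemidef.nonneg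
  have h2 : P⁻¹ * CFC.sqrt P * CFC.sqrt P = 1 := by
    rw [mul_assoc, h1, Matrix.nonsing_inv_mul _ ((Matrix.isUnit_iff_isUnit_det _).mp hP.isUnit)]
  have h3 := tendsto_sqrt_mulVec hP.posSemidef h
  have h4 : Continuous fun v : Fin n → ℝ => (P⁻¹ * CFC.sqrt P) *ᵥ v := by fun_prop
  have h5 := (h4.tendsto 0).comp h3
  simpa [Function.comp_def, Matrix.mulVec_mulVec, h2] using h5

end QuadraticForms

/-! ### The Riccati operator and completion of squares. -/

section Riccati

variable {n m : ℕ} (A : Matrix (Fin n) (Fin n) ℝ) (B : Matrix (Fin n) (Fin m) ℝ)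
  (Q : Matrix (Fin n) (Fin n) ℝ) (R : Matrix (Fin m) (Fin m) ℝ) (γ : ℝ)

/-- The Riccati operator of the discounted problem. -/
noncomputable def riccatiMap (P : Matrix (Fin n) (Fin n) ℝ) : Matrix (Fin n) (Fin n) ℝ :=
  Q + γ • (Aᵀ * P * A) -
    (γ • (Bᵀ * P * A))ᵀ * (R + γ • (Bᵀ * P * B))⁻¹ * (γ • (Bᵀ * P * A))

variable {A B Q R γ} {P : Matrix (Fin n) (Fin n) ℝ}

theorem posDef_add_smul (hR : R.PosDef) (hγ : 0 ≤ γ) (hP : P.PosSemidef) :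
    (R + γ • (Bᵀ * P * B)).PosDef := by
  refine hR.add_posSemidef (Matrix.PosSemidef.smul ?_ hγ)
  simpa using hP.conjTranspose_mul_mul_same B

/-- The factor `γ` is moved out of the inverse, which is legitimate because positive
semidefiniteness of `P` makes `R + γBᵀPB` invertible. -/
theorem solvesRiccati_iff (hR : R.PosDef) (hγ : 0 < γ) (hP : P.PosSemidef) :
    SolvesRiccati A B Q R γ P ↔ riccatiMap A B Q R γ P = P := by
  have hs : Real.sqrt γ * Real.sqrt γ = γ := Real.mul_self_sqrt hγ.le
  have hM := posDef_add_smul (B := B) hR hγ.le hP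
  have h1 : Bᵀ * P * B + (1 / γ) • R = γ⁻¹ • (R + γ • (Bᵀ * P * B)) := by
    rw [smul_add, smul_smul, inv_mul_cancel₀ hγ.ne', one_smul, one_div, add_comm]
  have h2 : (γ⁻¹ • (R + γ • (Bᵀ * P * B)))⁻¹ = γ • (R + γ • (Bᵀ * P * B))⁻¹ := by
    have := Matrix.inv_smul' (A := R + γ • (Bᵀ * P * B)) (Units.mk0 γ⁻¹ (inv_ne_zero hγ.ne'))
      ((Matrix.isUnit_iff_isUnit_det _).mp hM.isUnit)
    simpa [Units.smul_def] using this
  unfold SolvesRiccati riccatiMap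
  simp only [h1, h2]
  rw [← sub_eq_zero (b := P)]
  have hPt := transpose_eq_of_posSemidef hP
  have h3 : (Real.sqrt γ • A)ᵀ * P * (Real.sqrt γ • A) = γ • (Aᵀ * P * A) := by
    simp only [Matrix.transpose_smul, Matrix.smul_mul, Matrix.mul_smul, smul_smul, hs]
  have h4 : (Real.sqrt γ • A)ᵀ * P * B * (γ • (R + γ • (Bᵀ * P * B))⁻¹) * Bᵀ * P *
      (Real.sqrt γ • A) =
      (γ • (Bᵀ * P * A))ᵀ * (R + γ • (Bᵀ * P * B))⁻¹ * (γ • (Bᵀ * P * A)) := by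
    simp only [Matrix.transpose_smul, Matrix.smul_mul, Matrix.mul_smul, smul_smul,
      Matrix.transpose_mul, Matrix.transpose_transpose, hPt, Matrix.mul_assoc]
    congr 1
    linear_combination γ * hs
  rw [h3, h4]
  constructor <;> intro h <;> rw [← h] <;> abel

/-- Completion of squares in the one-step cost with quadratic terminal cost. -/
theorem quadForm_step (hR : R.PosDef) (hγ : 0 ≤ γ) (hP : P.PosSemidef)
    (x : Fin n → ℝ) (u : Fin m → ℝ) :
    quadForm Q x + quadForm R u + γ * quadForm P (A *ᵥ x + B *ᵥ u) =
      quadForm (riccatiMap A B Q R γ P) x +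
        quadForm (R + γ • (Bᵀ * P * B)) (u - optimalGain A B R γ P *ᵥ x) := by
  have hM := posDef_add_smul (B := B) hR hγ hP
  have hPt := transpose_eq_of_posSemidef hP
  have hMt := transpose_eq_of_posSemidef hM.posSemidef
  have hMu := (Matrix.isUnit_iff_isUnit_det _).mp hM.isUnit
  set M := R + γ • (Bᵀ * P * B) with hMdef
  set G := γ • (Bᵀ * P * A) with hG
  have e1 : u - optimalGain A B R γ P *ᵥ x = M⁻¹ *ᵥ (G *ᵥ x) + u := by
    simp only [optimalGain, ← hMdef, ← hG, Matrix.neg_mulVec, Matrix.mulVec_mulVec]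
    abel
  -- The cross term: `M` cancels against `M⁻¹`, leaving the mixed term of the form `P` at `Ax + Bu`.
  have e2 : u ⬝ᵥ M *ᵥ (M⁻¹ *ᵥ (G *ᵥ x)) = γ * ((B *ᵥ u) ⬝ᵥ P *ᵥ (A *ᵥ x)) := by
    rw [Matrix.mulVec_mulVec, Matrix.mul_nonsing_inv _ hMu, Matrix.one_mulVec, hG,
      Matrix.smul_mulVec, dotProduct_smul, smul_eq_mul, ← Matrix.mulVec_mulVec,
      ← Matrix.mulVec_mulVec, Matrix.dotProduct_mulVec, Matrix.vecMul_transpose]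
  have e3 : quadForm M (M⁻¹ *ᵥ (G *ᵥ x)) = quadForm (Gᵀ * M⁻¹ * G) x := by
    rw [← quadForm_mulVec, quadForm_mulVec, Matrix.transpose_nonsing_inv, hMt,
      Matrix.nonsing_inv_mul _ hMu, Matrix.one_mul]
  have e4 : quadForm M u = quadForm R u + γ * quadForm P (B *ᵥ u) := by
    rw [hMdef, quadForm_add_matrix, quadForm_smul_matrix, quadForm_mulVec]
  rw [e1, quadForm_add _ hMt, e2, e3, e4, quadForm_add _ hPt, riccatiMap, ← hMdef, ← hG,
    quadForm_sub_matrix, quadForm_add_matrix, quadForm_smul_matrix, quadForm_mulVec P A]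
  ring

theorem quadForm_riccatiMap_eq (hR : R.PosDef) (hγ : 0 ≤ γ) (hP : P.PosSemidef)
    (x : Fin n → ℝ) :
    quadForm (riccatiMap A B Q R γ P) x =
      quadForm Q x + quadForm R (optimalGain A B R γ P *ᵥ x) +
        γ * quadForm P (A *ᵥ x + B *ᵥ (optimalGain A B R γ P *ᵥ x)) := by
  rw [quadForm_step hR hγ hP, sub_self, quadForm_zero_right, add_zero]

/-- Together with `quadForm_riccatiMap_eq`, this makes `riccatiMap` a minimum over `u`, attained at
the optimal gain. -/
theorem quadForm_riccatiMap_le (hR : R.PosDef) (hγ : 0 ≤ γ) (hP : P.PosSemidef)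
    (x : Fin n → ℝ) (u : Fin m → ℝ) :
    quadForm (riccatiMap A B Q R γ P) x ≤
      quadForm Q x + quadForm R u + γ * quadForm P (A *ᵥ x + B *ᵥ u) := by
  rw [quadForm_step hR hγ hP]
  exact le_add_of_nonneg_right (quadForm_nonneg (posDef_add_smul hR hγ hP).posSemidef _)

theorem posSemidef_riccatiMap (hQ : Q.PosSemidef) (hR : R.PosDef) (hγ : 0 ≤ γ)
    (hP : P.PosSemidef) : (riccatiMap A B Q R γ P).PosSemidef := by
  refine posSemidef_of_quadForm ?_ fun x => ?_
  · have hPt := transpose_eq_of_posSemidef hP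
    have hMt := transpose_eq_of_posSemidef (posDef_add_smul (B := B) hR hγ hP).posSemidef
    have hQt := transpose_eq_of_posSemidef hQ
    simp only [riccatiMap, Matrix.transpose_sub, Matrix.transpose_add, Matrix.transpose_mul,
      Matrix.transpose_smul, Matrix.transpose_transpose, Matrix.transpose_nonsing_inv, hPt, hQt,
      transpose_eq_of_posSemidef hR.posSemidef, Matrix.mul_assoc]
  · rw [quadForm_riccatiMap_eq hR hγ hP]
    have h1 := quadForm_nonneg hQ x
    have h2 := quadForm_nonneg hR.posSemidef (optimalGain A B R γ P *ᵥ x)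
    have h3 := quadForm_nonneg hP (A *ᵥ x + B *ᵥ (optimalGain A B R γ P *ᵥ x))
    positivity

/-- A minimum is monotone in its terminal cost: the gain optimal for `P'` is used as a competitor
for `P`. -/
theorem quadForm_riccatiMap_mono (hR : R.PosDef) (hγ : 0 ≤ γ)
    {P' : Matrix (Fin n) (Fin n) ℝ} (hP : P.PosSemidef) (hP' : P'.PosSemidef)
    (h : ∀ x, quadForm P x ≤ quadForm P' x) (x : Fin n → ℝ) :
    quadForm (riccatiMap A B Q R γ P) x ≤ quadForm (riccatiMap A B Q R γ P') x := by
  rw [quadForm_riccatiMap_eq hR hγ hP']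
  refine (quadForm_riccatiMap_le hR hγ hP x (optimalGain A B R γ P' *ᵥ x)).trans ?_
  gcongr
  exact h _

theorem continuousAt_riccatiMap (hR : R.PosDef) (hγ : 0 ≤ γ) (hP : P.PosSemidef) :
    ContinuousAt (riccatiMap A B Q R γ) P := by
  have hM := posDef_add_smul (B := B) hR hγ hP
  have hMu := (Matrix.isUnit_iff_isUnit_det _).mp hM.isUnit
  have h1 : ContinuousAt (fun P : Matrix (Fin n) (Fin n) ℝ => (R + γ • (Bᵀ * P * B))⁻¹) P := by
    refine ContinuousAt.comp (f := fun P : Matrix (Fin n) (Fin n) ℝ => R + γ • (Bᵀ * P * B))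
      (g := fun M : Matrix (Fin m) (Fin m) ℝ => M⁻¹)
      (continuousAt_matrix_inv _ ?_) (by fun_prop)
    rw [Ring.inverse_eq_inv']
    exact continuousAt_inv₀ hMu.ne_zero
  have h2 : ContinuousAt (fun P : Matrix (Fin n) (Fin n) ℝ => γ • (Bᵀ * P * A)) P := by fun_prop
  have h3 : ContinuousAt (fun P : Matrix (Fin n) (Fin n) ℝ => Q + γ • (Aᵀ * P * A)) P := by
    fun_prop
  have h4 : ContinuousAt (fun P : Matrix (Fin n) (Fin n) ℝ => (γ • (Bᵀ * P * A))ᵀ) P := by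
    fun_prop
  have h5 : Continuous fun p : Matrix (Fin n) (Fin m) ℝ × Matrix (Fin m) (Fin m) ℝ ×
      Matrix (Fin m) (Fin n) ℝ => p.1 * p.2.1 * p.2.2 := by fun_prop
  exact h3.sub (ContinuousAt.comp (f := fun P : Matrix (Fin n) (Fin n) ℝ =>
    ((γ • (Bᵀ * P * A))ᵀ, (R + γ • (Bᵀ * P * B))⁻¹, γ • (Bᵀ * P * A)))
    h5.continuousAt (h4.prodMk (h1.prodMk h2)))

end Riccati

end DiscountedLQR
namespace DiscountedLQR

open Filter Topology

/-! ### Powers of Schur matrices. -/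

section Schur

open scoped Matrix.Norms.Operator

variable {n : ℕ}

/-- Gelfand's formula: the spectral radius is below some `r < 1`, so eventually the `k`-th power has
norm below `r ^ k`. -/
theorem IsSchur.summable_norm_pow {M : Matrix (Fin n) (Fin n) ℝ} (hM : IsSchur M) :
    Summable fun k => ‖M.map Complex.ofReal ^ k‖ := by
  -- In the zero algebra the spectrum is empty, so this case is treated apart.
  rcases subsingleton_or_nontrivial (Matrix (Fin n) (Fin n) ℂ) with h | h
  · simp [Subsingleton.elim (M.map Complex.ofReal ^ _) 0, summable_zero]
  set N := M.map Complex.ofReal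
  have h1 : spectralRadius ℂ N < ((1 : NNReal) : ℝ≥0∞) :=
    spectrum.spectralRadius_lt_of_forall_lt N fun z hz => by
      rw [← NNReal.coe_lt_coe]; simpa using hM z hz
  obtain ⟨r, hr1, hr2⟩ := ENNReal.lt_iff_exists_nnreal_btwn.mp h1
  have hr : (r : ℝ) < 1 := by exact_mod_cast hr2
  have h2 := (spectrum.pow_nnnorm_pow_one_div_tendsto_nhds_spectralRadius N).eventually_lt_const hr1
  refine Summable.of_norm_bounded_eventually_nat
    (summable_geometric_of_lt_one r.coe_nonneg hr) ?_
  filter_upwards [h2, eventually_gt_atTop 0] with k hk hk0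
  rw [norm_norm]
  have hk0' : (0 : ℝ) < k := by exact_mod_cast hk0
  have h3 := ENNReal.rpow_lt_rpow hk hk0'
  rw [← ENNReal.rpow_mul, one_div, inv_mul_cancel₀ hk0'.ne', ENNReal.rpow_one,
    ENNReal.rpow_natCast] at h3
  have h4 : ‖N ^ k‖₊ < r ^ k := by exact_mod_cast h3
  exact_mod_cast h4.le

/-- The powers of a Schur matrix are summable, as operators on `ℝⁿ`. -/
theorem IsSchur.exists_summable_bound {M : Matrix (Fin n) (Fin n) ℝ} (hM : IsSchur M) :
    ∃ b : ℕ → ℝ, Summable b ∧ (∀ k, 0 ≤ b k) ∧ ∀ k x, ‖M ^ k *ᵥ x‖ ≤ b k * ‖x‖ := by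
  refine ⟨_, hM.summable_norm_pow, fun k => norm_nonneg _, fun k x => ?_⟩
  -- Complexifying a real vector preserves its sup norm, so the complex operator bound applies to
  -- the real matrix.
  have h1 (y : Fin n → ℝ) : ‖Complex.ofReal ∘ y‖ = ‖y‖ := by
    simp [Pi.norm_def]
  have h2 : Complex.ofReal ∘ (M ^ k *ᵥ x) =
      (M.map Complex.ofReal ^ k) *ᵥ (Complex.ofReal ∘ x) := by
    have h3 : M.map Complex.ofReal ^ k = (M ^ k).map Complex.ofReal :=
      (map_pow (Complex.ofRealHom.mapMatrix (m := Fin n)) M k).symm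
    rw [h3]
    ext i
    exact RingHom.map_mulVec Complex.ofRealHom (M ^ k) x i
  rw [← h1, h2, ← h1 x]
  exact Matrix.linfty_opNorm_mulVec _ _

end Schur

/-! ### Linear recursions with vanishing input. -/

section LinearSystems

variable {n m : ℕ}

/-- Variation of constants. The truncated subtraction is harmless, as `j < k` throughout the sum. -/
theorem linear_recursion_eq {M : Matrix (Fin n) (Fin n) ℝ} {z g : ℕ → Fin n → ℝ}
    (hz : ∀ k, z (k + 1) = M *ᵥ z k + g k) (k : ℕ) :
    z k = M ^ k *ᵥ z 0 + ∑ j ∈ Finset.range k, M ^ j *ᵥ g (k - 1 - j) := by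
  induction k with
  | zero => simp
  | succ k ih =>
    rw [hz, ih, Finset.sum_range_succ', Matrix.mulVec_add, Matrix.mulVec_mulVec, ← pow_succ',
      Matrix.mulVec_sum, add_assoc]
    congr 2
    · refine Finset.sum_congr rfl fun j _ => ?_
      rw [Matrix.mulVec_mulVec, ← pow_succ']
      congr 2
      omega
    · simp

/-- A linear recursion whose matrix has summable powers and whose input vanishes asymptotically
tends to zero. -/
theorem tendsto_zero_of_linear_recursion {M : Matrix (Fin n) (Fin n) ℝ} {b : ℕ → ℝ}
    (hb : Summable b) (hb0 : ∀ k, 0 ≤ b k) (hM : ∀ k x, ‖M ^ k *ᵥ x‖ ≤ b k * ‖x‖)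
    {z g : ℕ → Fin n → ℝ} (hz : ∀ k, z (k + 1) = M *ᵥ z k + g k)
    (hg : Tendsto g atTop (𝓝 0)) : Tendsto z atTop (𝓝 0) := by
  obtain ⟨C, hC⟩ : ∃ C, ∀ k, ‖g k‖ ≤ C := by
    obtain ⟨C, hC⟩ := hg.norm.bddAbove_range
    exact ⟨C, fun k => hC ⟨k, rfl⟩⟩
  have hC0 : 0 ≤ C := (norm_nonneg _).trans (hC 0)
  have h1 : Tendsto (fun k => M ^ k *ᵥ z 0) atTop (𝓝 0) := by
    refine squeeze_zero_norm (fun k => hM k _) ?_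
    simpa using hb.tendsto_atTop_zero.mul_const ‖z 0‖
  -- The convolution is extended by zero to all `j`; each term vanishes as `k → ∞` and is dominated
  -- by `b j * C`.
  have h2 : Tendsto (fun k => ∑' j, if j < k then M ^ j *ᵥ g (k - 1 - j) else 0) atTop
      (𝓝 (∑' _ : ℕ, (0 : Fin n → ℝ))) := by
    refine tendsto_tsum_of_dominated_convergence (bound := fun j => b j * C) (hb.mul_right C)
      (fun j => ?_) (Eventually.of_forall fun k j => ?_)
    · have h3 : Tendsto (fun k => M ^ j *ᵥ g (k - 1 - j)) atTop (𝓝 0) := by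
        have hc : Continuous fun v : Fin n → ℝ => M ^ j *ᵥ v := by fun_prop
        have h4 : Tendsto (fun k => k - 1 - j) atTop atTop :=
          (tendsto_sub_atTop_nat j).comp (tendsto_sub_atTop_nat 1)
        simpa [Function.comp_def] using (hc.tendsto 0).comp (hg.comp h4)
      refine h3.congr' ?_
      filter_upwards [eventually_gt_atTop j] with k hk
      rw [if_pos hk]
    · split_ifs
      · exact (hM _ _).trans (mul_le_mul_of_nonneg_left (hC _) (hb0 j))
      · simpa using mul_nonneg (hb0 j) hC0
  have h3 : z = fun k => M ^ k *ᵥ z 0 +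
      ∑' j, if j < k then M ^ j *ᵥ g (k - 1 - j) else 0 := by
    funext k
    rw [linear_recursion_eq hz k, tsum_eq_sum (s := Finset.range k)]
    · congr 1
      refine Finset.sum_congr rfl fun j hj => ?_
      rw [if_pos (Finset.mem_range.mp hj)]
    · intro j hj
      rw [if_neg (by simpa using hj)]
  rw [h3]
  simpa using h1.add h2

end LinearSystems

/-! ### Existence and uniqueness for the Riccati equation. -/

section RiccatiEquation

variable {n m : ℕ} {A : Matrix (Fin n) (Fin n) ℝ} {B : Matrix (Fin n) (Fin m) ℝ}
  {Q : Matrix (Fin n) (Fin n) ℝ} {R : Matrix (Fin m) (Fin m) ℝ} {γ : ℝ}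

/-- Detectability: along a trajectory of finite discounted cost the discounted state vanishes. -/
theorem tendsto_discounted_state (hQ : Q.PosSemidef) (hR : R.PosDef)
    (hγ : γ ∈ Set.Ioo (0 : ℝ) 1) (hdet : IsDetectable A (CFC.sqrt Q))
    {x : ℕ → Fin n → ℝ} {u : ℕ → Fin m → ℝ} (hx : ∀ k, x (k + 1) = A *ᵥ x k + B *ᵥ u k)
    (hc : Summable fun k => γ ^ k * (quadForm Q (x k) + quadForm R (u k))) :
    Tendsto (fun k => Real.sqrt γ ^ k • x k) atTop (𝓝 0) := by
  obtain ⟨L, hL⟩ := hdet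
  obtain ⟨b, hb, hb0, hbM⟩ := hL.exists_summable_bound
  set C := CFC.sqrt Q
  set s := Real.sqrt γ with hs
  have hs0 : 0 ≤ s := Real.sqrt_nonneg _
  have hs1 : s ≤ 1 := Real.sqrt_le_one.mpr hγ.2.le
  have hsk (k : ℕ) : (s ^ k) ^ 2 = γ ^ k := by
    rw [← pow_mul, mul_comm, pow_mul, hs, Real.sq_sqrt hγ.1.le]
  have hγk (k : ℕ) : 0 ≤ γ ^ k := pow_nonneg hγ.1.le k
  have hlim := hc.tendsto_atTop_zero
  have hxQ : Tendsto (fun k => quadForm Q (s ^ k • x k)) atTop (𝓝 0) := by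
    refine squeeze_zero (fun k => quadForm_nonneg hQ _) (fun k => ?_) hlim
    rw [quadForm_smul, hsk]
    exact mul_le_mul_of_nonneg_left
      (le_add_of_nonneg_right (quadForm_nonneg hR.posSemidef _)) (hγk k)
  have huR : Tendsto (fun k => quadForm R (s ^ k • u k)) atTop (𝓝 0) := by
    refine squeeze_zero (fun k => quadForm_nonneg hR.posSemidef _) (fun k => ?_) hlim
    rw [quadForm_smul, hsk]
    exact mul_le_mul_of_nonneg_left
      (le_add_of_nonneg_left (quadForm_nonneg hQ _)) (hγk k)
  have h1 := tendsto_sqrt_mulVec hQ hxQ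
  have h2 := tendsto_zero_of_quadForm hR huR
  have h3 : Tendsto (fun k => s • (B *ᵥ (s ^ k • u k) - L *ᵥ (C *ᵥ (s ^ k • x k)))) atTop
      (𝓝 0) := by
    have hcB : Continuous fun v : Fin m → ℝ => B *ᵥ v := by fun_prop
    have hcL : Continuous fun v : Fin n → ℝ => L *ᵥ v := by fun_prop
    have h4 := (((hcB.tendsto 0).comp h2).sub ((hcL.tendsto 0).comp h1)).const_smul s
    simpa [Function.comp_def] using h4
  -- Output injection: `Ax + Bu = (A + LC)x + (Bu - LCx)`, where finite cost makes the scaled `u`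
  -- and `Cx` vanish. As `s ≤ 1`, the bound `b` for `A + LC` still serves after scaling.
  refine tendsto_zero_of_linear_recursion (M := s • (A + L * C)) hb hb0 (fun k v => ?_)
    (fun k => ?_) h3
  · rw [smul_pow, Matrix.smul_mulVec, norm_smul, Real.norm_of_nonneg (pow_nonneg hs0 k)]
    exact (mul_le_of_le_one_left (norm_nonneg _) (pow_le_one₀ hs0 hs1)).trans (hbM k v)
  · rw [hx, pow_succ']
    simp only [Matrix.smul_mulVec, Matrix.mulVec_smul, Matrix.add_mulVec, ← Matrix.mulVec_mulVec,
      smul_add, smul_sub, smul_smul, mul_comm (s ^ k) s]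
    abel

/-- `quadForm_step` telescoped at a fixed point, for arbitrary controls. -/
theorem sum_add_quadForm_of_riccati (hR : R.PosDef) (hγ : 0 ≤ γ)
    {P : Matrix (Fin n) (Fin n) ℝ} (hP : P.PosSemidef) (hfix : riccatiMap A B Q R γ P = P)
    {x : ℕ → Fin n → ℝ} {u : ℕ → Fin m → ℝ} (hx : ∀ k, x (k + 1) = A *ᵥ x k + B *ᵥ u k)
    (N : ℕ) :
    ∑ k ∈ Finset.range N, γ ^ k * (quadForm Q (x k) + quadForm R (u k)) +
        γ ^ N * quadForm P (x N) =
      quadForm P (x 0) + ∑ k ∈ Finset.range N, γ ^ k *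
        quadForm (R + γ • (Bᵀ * P * B)) (u k - optimalGain A B R γ P *ᵥ x k) := by
  induction N with
  | zero => simp
  | succ N ih =>
    have h := quadForm_step (A := A) (B := B) (Q := Q) hR hγ hP (x N) (u N)
    rw [hfix, ← hx] at h
    rw [Finset.sum_range_succ, Finset.sum_range_succ, pow_succ]
    linear_combination ih + γ ^ N * h

/-- The closed loop of `P` costs at most `xᵀPx`, while by the telescoped identity for `P'` any
trajectory costs at least `xᵀP'x` minus a terminal term. -/
theorem quadForm_le_of_riccati (hQ : Q.PosSemidef) (hR : R.PosDef)
    (hγ : γ ∈ Set.Ioo (0 : ℝ) 1) (hdet : IsDetectable A (CFC.sqrt Q))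
    {P P' : Matrix (Fin n) (Fin n) ℝ} (hP : P.PosSemidef) (hP' : P'.PosSemidef)
    (hfix : riccatiMap A B Q R γ P = P) (hfix' : riccatiMap A B Q R γ P' = P')
    (x : Fin n → ℝ) : quadForm P' x ≤ quadForm P x := by
  set F := optimalGain A B R γ P
  let y : ℕ → Fin n → ℝ := fun k => (A + B * F) ^ k *ᵥ x
  have hy (k : ℕ) : y (k + 1) = A *ᵥ y k + B *ᵥ (F *ᵥ y k) := by
    simp only [y, pow_succ', ← Matrix.mulVec_mulVec, Matrix.add_mulVec]
  have hγk (k : ℕ) : 0 ≤ γ ^ k := pow_nonneg hγ.1.le k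
  have hy0 : y 0 = x := by simp [y]
  have h1 (N : ℕ) : ∑ k ∈ Finset.range N, γ ^ k * (quadForm Q (y k) + quadForm R (F *ᵥ y k)) +
      γ ^ N * quadForm P (y N) = quadForm P x := by
    rw [sum_add_quadForm_of_riccati hR hγ.1.le hP hfix hy N, hy0]
    simp [F, quadForm_zero_right]
  have h2 (N : ℕ) : ∑ k ∈ Finset.range N, γ ^ k * (quadForm Q (y k) + quadForm R (F *ᵥ y k)) ≤
      quadForm P x :=
    (le_add_of_nonneg_right (mul_nonneg (hγk N) (quadForm_nonneg hP _))).trans (h1 N).le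
  have h3 : Summable fun k => γ ^ k * (quadForm Q (y k) + quadForm R (F *ᵥ y k)) :=
    summable_of_sum_range_le (fun k => mul_nonneg (hγk k)
      (add_nonneg (quadForm_nonneg hQ _) (quadForm_nonneg hR.posSemidef _))) h2
  have h4 := tendsto_discounted_state hQ hR hγ hdet hy h3
  -- Detectability removes the terminal term of `P'`, which the finite cost of the loop does not
  -- control directly.
  have h5 : Tendsto (fun N => γ ^ N * quadForm P' (y N)) atTop (𝓝 0) := by
    have h6 := ((continuous_quadForm P').tendsto 0).comp h4
    rw [quadForm_zero_right] at h6
    refine h6.congr fun k => ?_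
    simp only [Function.comp_apply]
    rw [quadForm_smul, ← pow_mul, mul_comm k, pow_mul, Real.sq_sqrt hγ.1.le]
  have h7 : Tendsto (fun N => quadForm P x + γ ^ N * quadForm P' (y N)) atTop
      (𝓝 (quadForm P x)) := by simpa using h5.const_add (quadForm P x)
  refine ge_of_tendsto' h7 fun N => ?_
  calc quadForm P' x = quadForm P' (y 0) := by rw [hy0]
    _ ≤ _ := le_add_of_nonneg_right (Finset.sum_nonneg fun k _ => mul_nonneg (hγk k)
        (quadForm_nonneg (posDef_add_smul hR hγ.1.le hP').posSemidef _))
    _ = _ := (sum_add_quadForm_of_riccati hR hγ.1.le hP' hfix' hy N).symm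
    _ ≤ _ := add_le_add_left (h2 N) _

theorem riccati_unique (hQ : Q.PosSemidef) (hR : R.PosDef)
    (hγ : γ ∈ Set.Ioo (0 : ℝ) 1) (hdet : IsDetectable A (CFC.sqrt Q))
    {P P' : Matrix (Fin n) (Fin n) ℝ} (hP : P.PosSemidef) (hP' : P'.PosSemidef)
    (hfix : riccatiMap A B Q R γ P = P) (hfix' : riccatiMap A B Q R γ P' = P') : P = P' :=
  eq_of_quadForm_eq (transpose_eq_of_posSemidef hP) (transpose_eq_of_posSemidef hP') fun x =>
    le_antisymm (quadForm_le_of_riccati hQ hR hγ hdet hP' hP hfix' hfix x)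
      (quadForm_le_of_riccati hQ hR hγ hdet hP hP' hfix hfix' x)

variable (A B Q R γ) in
/-- Value iteration for the Riccati equation, started at zero. -/
noncomputable def riccatiIter : ℕ → Matrix (Fin n) (Fin n) ℝ
  | 0 => 0
  | N + 1 => riccatiMap A B Q R γ (riccatiIter N)

theorem posSemidef_riccatiIter (hQ : Q.PosSemidef) (hR : R.PosDef) (hγ : 0 ≤ γ) (N : ℕ) :
    (riccatiIter A B Q R γ N).PosSemidef := by
  induction N with
  | zero => exact Matrix.PosSemidef.zero
  | succ N ih => exact posSemidef_riccatiMap hQ hR hγ ih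

/-- The first iterate dominates `0`, and monotonicity of `riccatiMap` propagates the order. -/
theorem monotone_quadForm_riccatiIter (hQ : Q.PosSemidef) (hR : R.PosDef) (hγ : 0 ≤ γ)
    (x : Fin n → ℝ) : Monotone fun N => quadForm (riccatiIter A B Q R γ N) x := by
  refine monotone_nat_of_le_succ fun N => ?_
  induction N generalizing x with
  | zero =>
    simpa [riccatiIter, quadForm] using
      quadForm_nonneg (posSemidef_riccatiIter (A := A) (B := B) hQ hR hγ 1) x
  | succ N ih =>
    exact quadForm_riccatiMap_mono hR hγ (posSemidef_riccatiIter hQ hR hγ N)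
      (posSemidef_riccatiIter hQ hR hγ (N + 1)) ih x

/-- Stabilizability bounds the value iteration. -/
theorem exists_quadForm_riccatiIter_le (hQ : Q.PosSemidef) (hR : R.PosDef)
    (hγ : γ ∈ Set.Ioo (0 : ℝ) 1) (hstab : IsStabilizable A B) (x : Fin n → ℝ) :
    ∃ U, ∀ N, quadForm (riccatiIter A B Q R γ N) x ≤ U := by
  obtain ⟨K, hK⟩ := hstab
  obtain ⟨b, hb, hb0, hbM⟩ := hK.exists_summable_bound
  obtain ⟨D, hD⟩ : ∃ D, ∀ k, b k ≤ D := by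
    obtain ⟨D, hD⟩ := hb.tendsto_atTop_zero.bddAbove_range
    exact ⟨D, fun k => hD ⟨k, rfl⟩⟩
  set M := A + B * K
  set S := Q + Kᵀ * R * K
  have hS : S.PosSemidef := hQ.add (by
    simpa using hR.posSemidef.conjTranspose_mul_mul_same K)
  have hγk (k : ℕ) : 0 ≤ γ ^ k := pow_nonneg hγ.1.le k
  have hsum (x : Fin n → ℝ) : Summable fun k => γ ^ k * quadForm S (M ^ k *ᵥ x) := by
    refine Summable.of_nonneg_of_le (fun k => mul_nonneg (hγk k) (quadForm_nonneg hS _))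
      (fun k => mul_le_mul_of_nonneg_left ?_ (hγk k))
      ((summable_geometric_of_lt_one hγ.1.le hγ.2).mul_right
        ((∑ i, ∑ j, |S i j|) * (D * ‖x‖) ^ 2))
    refine (quadForm_le_norm S _).trans (mul_le_mul_of_nonneg_left ?_
      (Finset.sum_nonneg fun i _ => Finset.sum_nonneg fun j _ => abs_nonneg _))
    have := (hbM k x).trans (mul_le_mul_of_nonneg_right (hD k) (norm_nonneg x))
    gcongr
  -- The bound is the noise-free cost of `u = Kx`; one step splits off its first term and restarts
  -- the series at `Mx`.
  refine ⟨∑' k, γ ^ k * quadForm S (M ^ k *ᵥ x), fun N => ?_⟩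
  induction N generalizing x with
  | zero =>
    simpa [riccatiIter, quadForm] using
      tsum_nonneg fun k => mul_nonneg (hγk k) (quadForm_nonneg hS (M ^ k *ᵥ x))
  | succ N ih =>
    refine (quadForm_riccatiMap_le hR hγ.1.le (posSemidef_riccatiIter hQ hR hγ.1.le N) x
      (K *ᵥ x)).trans ?_
    have h1 : A *ᵥ x + B *ᵥ (K *ᵥ x) = M *ᵥ x := by
      simp only [M, Matrix.add_mulVec, Matrix.mulVec_mulVec]
    have h2 : quadForm Q x + quadForm R (K *ᵥ x) = quadForm S x := by
      rw [quadForm_mulVec, quadForm_add_matrix]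
    rw [h1, h2, (hsum x).tsum_eq_zero_add]
    simp only [pow_zero, one_mul, Matrix.one_mulVec]
    refine add_le_add_right ?_ _
    refine (mul_le_mul_of_nonneg_left (ih (M *ᵥ x)) hγ.1.le).trans_eq ?_
    rw [← tsum_mul_left]
    refine tsum_congr fun k => ?_
    rw [Matrix.mulVec_mulVec, ← pow_succ]
    ring

/-- Value iteration converges to a positive semidefinite solution of the Riccati equation. -/
theorem exists_tendsto_riccatiIter (hQ : Q.PosSemidef) (hR : R.PosDef)
    (hγ : γ ∈ Set.Ioo (0 : ℝ) 1) (hstab : IsStabilizable A B) :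
    ∃ P : Matrix (Fin n) (Fin n) ℝ, P.PosSemidef ∧ riccatiMap A B Q R γ P = P ∧
      Tendsto (riccatiIter A B Q R γ) atTop (𝓝 P) := by
  have hpsd := posSemidef_riccatiIter (A := A) (B := B) hQ hR hγ.1.le
  have h1 (x : Fin n → ℝ) :
      ∃ l, Tendsto (fun N => quadForm (riccatiIter A B Q R γ N) x) atTop (𝓝 l) := by
    obtain ⟨U, hU⟩ := exists_quadForm_riccatiIter_le hQ hR hγ hstab x
    exact ⟨_, tendsto_atTop_ciSup (monotone_quadForm_riccatiIter hQ hR hγ.1.le x)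
      ⟨U, by rintro _ ⟨N, rfl⟩; exact hU N⟩⟩
  choose l hl using h1
  obtain ⟨P, hP⟩ : ∃ P : Matrix (Fin n) (Fin n) ℝ,
      Tendsto (riccatiIter A B Q R γ) atTop (𝓝 P) := by
    -- Polarization turns limits of the quadratic forms into limits of the entries.
    refine ⟨fun i j => (l (Pi.single i 1 + Pi.single j 1) - l (Pi.single i 1)
      - l (Pi.single j 1)) / 2, ?_⟩
    refine tendsto_pi_nhds.mpr fun i => tendsto_pi_nhds.mpr fun j => ?_
    simp_rw [fun N => apply_eq_quadForm (transpose_eq_of_posSemidef (hpsd N)) i j]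
    exact (((hl _).sub (hl _)).sub (hl _)).div_const 2
  have hPt : Pᵀ = P := by
    have hc : Continuous fun M : Matrix (Fin n) (Fin n) ℝ => Mᵀ := by fun_prop
    refine tendsto_nhds_unique ((hc.tendsto P).comp hP) (hP.congr fun N => ?_)
    exact (transpose_eq_of_posSemidef (hpsd N)).symm
  have hPpsd : P.PosSemidef := posSemidef_of_quadForm hPt fun x =>
    ge_of_tendsto' (((continuous_quadForm_left x).tendsto P).comp hP)
      fun N => quadForm_nonneg (hpsd N) x
  refine ⟨P, hPpsd, ?_, hP⟩
  exact tendsto_nhds_unique ((continuousAt_riccatiMap hR hγ.1.le hPpsd).tendsto.comp hP)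
    ((tendsto_add_atTop_iff_nat 1).mpr hP)

end RiccatiEquation

end DiscountedLQR
namespace DiscountedLQR

open Filter Topology

/-! ### Dynamic programming for general controlled systems. -/

section ControlledSystems

variable {Ω X U W : Type*} [MeasurableSpace Ω] [MeasurableSpace X] [MeasurableSpace U]

/-- The policy `(π₁, π₂, …)` that remains after the first step. -/
def Policy.shift (π : Policy X U) : Policy X U :=
  ⟨fun k => π.act (k + 1), fun k => π.measurable_act (k + 1)⟩

theorem Policy.shift_stationary (φ : X → U) (hφ : Measurable φ) :
    (Policy.stationary φ hφ).shift = Policy.stationary φ hφ := rfl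

/-- The recursion defining `trajectory` peels off the last step; dynamic programming needs the
first. -/
theorem trajectory_succ (f : X → U → W → X) (π : Policy X U) (x : X) (w : ℕ → W) (k : ℕ) :
    trajectory f π x w (k + 1) =
      trajectory f π.shift (f x (π.act 0 x) (w 0)) (fun j => w (j + 1)) k := by
  induction k with
  | zero => rfl
  | succ k ih => rw [trajectory, ih]; rfl

/-- The discounted cost of the first `N` steps of one realization. -/
noncomputable def partialCost (f : X → U → W → X) (ℓ : X → U → ℝ) (γ : ℝ) (π : Policy X U)
    (x : X) (w : ℕ → W) (N : ℕ) : ℝ≥0∞ :=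
  ∑ k ∈ Finset.range N, ENNReal.ofReal
    (γ ^ k * ℓ (trajectory f π x w k) (π.act k (trajectory f π x w k)))

/-- The expected discounted cost of the first `N` steps from the state `x`. -/
noncomputable def partialValue (Pr : Measure Ω) (f : X → U → W → X) (ℓ : X → U → ℝ) (γ : ℝ)
    (w : ℕ → Ω → W) (π : Policy X U) (N : ℕ) (x : X) : ℝ≥0∞ :=
  ∫⁻ ω, partialCost f ℓ γ π x (fun k => w k ω) N ∂Pr

variable {f : X → U → W → X} {ℓ : X → U → ℝ} {γ : ℝ}

theorem stageCost_succ (hγ : 0 ≤ γ) (π : Policy X U) (x : X) (w : ℕ → W) (k : ℕ) :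
    ENNReal.ofReal (γ ^ (k + 1) *
        ℓ (trajectory f π x w (k + 1)) (π.act (k + 1) (trajectory f π x w (k + 1)))) =
      ENNReal.ofReal γ * ENNReal.ofReal (γ ^ k *
        ℓ (trajectory f π.shift (f x (π.act 0 x) (w 0)) (fun j => w (j + 1)) k)
          (π.shift.act k
            (trajectory f π.shift (f x (π.act 0 x) (w 0)) (fun j => w (j + 1)) k))) := by
  rw [trajectory_succ, ← ENNReal.ofReal_mul hγ, pow_succ', mul_assoc]
  rfl

theorem pathCost_eq_add (hγ : 0 ≤ γ) (π : Policy X U) (x : X) (w : ℕ → W) :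
    pathCost f ℓ γ π x w = ENNReal.ofReal (ℓ x (π.act 0 x)) + ENNReal.ofReal γ *
      pathCost f ℓ γ π.shift (f x (π.act 0 x) (w 0)) (fun j => w (j + 1)) := by
  rw [pathCost, tsum_eq_zero_add' ENNReal.summable, pathCost, ← ENNReal.tsum_mul_left]
  simp_rw [stageCost_succ hγ]
  simp [trajectory]

theorem partialCost_succ (hγ : 0 ≤ γ) (π : Policy X U) (x : X) (w : ℕ → W) (N : ℕ) :
    partialCost f ℓ γ π x w (N + 1) = ENNReal.ofReal (ℓ x (π.act 0 x)) + ENNReal.ofReal γ *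
      partialCost f ℓ γ π.shift (f x (π.act 0 x) (w 0)) (fun j => w (j + 1)) N := by
  rw [partialCost, Finset.sum_range_succ', partialCost, Finset.mul_sum, add_comm]
  simp_rw [stageCost_succ hγ]
  simp [trajectory]

variable [MeasurableSpace W]

theorem measurable_trajectory
    (hf : Measurable fun p : X × U × W => f p.1 p.2.1 p.2.2) (π : Policy X U) (k : ℕ) :
    Measurable fun p : X × (ℕ → W) => trajectory f π p.1 p.2 k := by
  induction k with
  | zero => exact measurable_fst
  | succ k ih =>
    exact hf.comp (ih.prodMk (((π.measurable_act k).comp ih).prodMk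
      ((measurable_pi_apply k).comp measurable_snd)))

theorem measurable_stageCost (hf : Measurable fun p : X × U × W => f p.1 p.2.1 p.2.2)
    (hℓ : Measurable fun p : X × U => ℓ p.1 p.2) (π : Policy X U) (k : ℕ) :
    Measurable fun p : X × (ℕ → W) => ENNReal.ofReal
      (γ ^ k * ℓ (trajectory f π p.1 p.2 k) (π.act k (trajectory f π p.1 p.2 k))) := by
  have h := measurable_trajectory hf π k
  exact ENNReal.measurable_ofReal.comp
    ((hℓ.comp (h.prodMk ((π.measurable_act k).comp h))).const_mul _)

theorem measurable_pathCost (hf : Measurable fun p : X × U × W => f p.1 p.2.1 p.2.2)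
    (hℓ : Measurable fun p : X × U => ℓ p.1 p.2) (π : Policy X U) :
    Measurable fun p : X × (ℕ → W) => pathCost f ℓ γ π p.1 p.2 :=
  Measurable.tsum fun k => measurable_stageCost hf hℓ π k

theorem measurable_partialCost (hf : Measurable fun p : X × U × W => f p.1 p.2.1 p.2.2)
    (hℓ : Measurable fun p : X × U => ℓ p.1 p.2) (π : Policy X U) (N : ℕ) :
    Measurable fun p : X × (ℕ → W) => partialCost f ℓ γ π p.1 p.2 N :=
  Finset.measurable_fun_sum _ fun k _ => measurable_stageCost hf hℓ π k

variable {Pr : Measure Ω} {w : ℕ → Ω → W}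

theorem value_eq_iSup (hf : Measurable fun p : X × U × W => f p.1 p.2.1 p.2.2)
    (hℓ : Measurable fun p : X × U => ℓ p.1 p.2) (hw : ∀ k, Measurable (w k))
    (π : Policy X U) (x : X) :
    value Pr f ℓ γ w π x = ⨆ N, partialValue Pr f ℓ γ w π N x := by
  simp only [value, partialValue]
  rw [← lintegral_iSup]
  · refine lintegral_congr fun ω => ?_
    exact ENNReal.tsum_eq_iSup_nat
  · intro N
    exact (measurable_partialCost hf hℓ π N).comp
      (measurable_const.prodMk (measurable_pi_lambda _ hw))
  · intro N N' h ω
    exact Finset.sum_le_sum_of_subset (Finset.range_mono h)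

theorem indepFun_zero_tail (hw : ∀ k, Measurable (w k)) (hi : iIndepFun w Pr) :
    IndepFun (w 0) (fun ω k => w (k + 1) ω) Pr := by
  have h := indep_iSup_of_disjoint (fun k => (hw k).comap_le) hi.iIndep
    (S := {0}) (T := {k | k ≠ 0}) (by simp)
  rw [IndepFun_iff_Indep]
  refine indep_of_indep_of_le_left (indep_of_indep_of_le_right h ?_) ?_
  · rw [MeasurableSpace.pi, MeasurableSpace.comap_iSup]
    refine iSup_le fun k => ?_
    rw [MeasurableSpace.comap_comp]
    exact le_iSup₂_of_le (k + 1) (Nat.succ_ne_zero k) le_rfl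
  · exact le_iSup₂_of_le 0 rfl le_rfl

/-- Both laws are the same infinite product, by independence and identical distribution. -/
theorem map_tail (hw : ∀ k, Measurable (w k)) (hi : iIndepFun w Pr)
    (hid : ∀ k, IdentDistrib (w k) (w 0) Pr Pr) :
    Pr.map (fun ω k => w (k + 1) ω) = Pr.map (fun ω k => w k ω) := by
  have hi' : iIndepFun (fun k => w (k + 1)) Pr := hi.precomp (add_left_injective 1)
  rw [hi'.map_fun_eq_infinitePi_map fun k => hw _, hi.map_fun_eq_infinitePi_map hw]
  congr 1
  funext k
  rw [(hid (k + 1)).map_eq, (hid k).map_eq]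

variable [IsProbabilityMeasure Pr]

/-- Integration over the first disturbance and an independent copy of the later ones. -/
theorem lintegral_first_disturbance (hw : ∀ k, Measurable (w k)) (hi : iIndepFun w Pr)
    (hid : ∀ k, IdentDistrib (w k) (w 0) Pr Pr) {h : W × (ℕ → W) → ℝ≥0∞} (hh : Measurable h) :
    ∫⁻ ω, h (w 0 ω, fun k => w (k + 1) ω) ∂Pr =
      ∫⁻ ω, ∫⁻ ω', h (w 0 ω, fun k => w k ω') ∂Pr ∂Pr := by
  have hm : Measurable fun ω k => w k ω := measurable_pi_lambda _ hw
  have hm' : Measurable fun ω k => w (k + 1) ω := measurable_pi_lambda _ fun k => hw _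
  have h1 := (indepFun_iff_map_prod_eq_prod_map_map (hw 0).aemeasurable hm'.aemeasurable).mp
    (indepFun_zero_tail hw hi)
  have := Measure.isProbabilityMeasure_map (μ := Pr) hm.aemeasurable
  rw [← lintegral_map hh ((hw 0).prodMk hm'), h1, map_tail hw hi hid,
    lintegral_prod _ hh.aemeasurable, lintegral_map hh.lintegral_prod_right' (hw 0)]
  refine lintegral_congr fun ω => ?_
  exact lintegral_map (hh.comp measurable_prodMk_left) hm

/-- Here `g` is the cost-to-go, over an infinite or finite horizon; both cases are used below. -/
theorem lintegral_step (hf : Measurable fun p : X × U × W => f p.1 p.2.1 p.2.2)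
    (hw : ∀ k, Measurable (w k)) (hi : iIndepFun w Pr)
    (hid : ∀ k, IdentDistrib (w k) (w 0) Pr Pr) {g : X × (ℕ → W) → ℝ≥0∞} (hg : Measurable g)
    (x : X) (u : U) :
    ∫⁻ ω, (ENNReal.ofReal (ℓ x u) +
        ENNReal.ofReal γ * g (f x u (w 0 ω), fun k => w (k + 1) ω)) ∂Pr =
      ENNReal.ofReal (ℓ x u) +
        ENNReal.ofReal γ * ∫⁻ ω, ∫⁻ ω', g (f x u (w 0 ω), fun k => w k ω') ∂Pr ∂Pr := by
  have h0 : Measurable fun p : W × (ℕ → W) => g (f x u p.1, p.2) :=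
    hg.comp ((hf.comp (measurable_const.prodMk (measurable_const.prodMk measurable_fst))).prodMk
      measurable_snd)
  have h1 : Measurable fun ω => g (f x u (w 0 ω), fun k => w (k + 1) ω) :=
    h0.comp ((hw 0).prodMk (measurable_pi_lambda _ fun k => hw (k + 1)))
  rw [lintegral_add_left measurable_const, lintegral_const, measure_univ, mul_one,
    lintegral_const_mul _ h1, lintegral_first_disturbance hw hi hid h0]

theorem value_eq_add (hf : Measurable fun p : X × U × W => f p.1 p.2.1 p.2.2)
    (hℓ : Measurable fun p : X × U => ℓ p.1 p.2) (hγ : 0 ≤ γ)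
    (hw : ∀ k, Measurable (w k)) (hi : iIndepFun w Pr)
    (hid : ∀ k, IdentDistrib (w k) (w 0) Pr Pr) (π : Policy X U) (x : X) :
    value Pr f ℓ γ w π x = ENNReal.ofReal (ℓ x (π.act 0 x)) + ENNReal.ofReal γ *
      ∫⁻ ω, value Pr f ℓ γ w π.shift (f x (π.act 0 x) (w 0 ω)) ∂Pr := by
  simp only [value]
  simp_rw [pathCost_eq_add hγ π]
  exact lintegral_step hf hw hi hid (measurable_pathCost hf hℓ π.shift) x (π.act 0 x)

theorem partialValue_succ (hf : Measurable fun p : X × U × W => f p.1 p.2.1 p.2.2)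
    (hℓ : Measurable fun p : X × U => ℓ p.1 p.2) (hγ : 0 ≤ γ)
    (hw : ∀ k, Measurable (w k)) (hi : iIndepFun w Pr)
    (hid : ∀ k, IdentDistrib (w k) (w 0) Pr Pr) (π : Policy X U) (N : ℕ) (x : X) :
    partialValue Pr f ℓ γ w π (N + 1) x = ENNReal.ofReal (ℓ x (π.act 0 x)) + ENNReal.ofReal γ *
      ∫⁻ ω, partialValue Pr f ℓ γ w π.shift N (f x (π.act 0 x) (w 0 ω)) ∂Pr := by
  simp only [partialValue]
  simp_rw [partialCost_succ hγ π]
  exact lintegral_step hf hw hi hid (measurable_partialCost hf hℓ π.shift N) x (π.act 0 x)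

/-- `J(π) = E[V^π(x₀)]`. -/
theorem cost_eq_lintegral_value (hf : Measurable fun p : X × U × W => f p.1 p.2.1 p.2.2)
    (hℓ : Measurable fun p : X × U => ℓ p.1 p.2) (hw : ∀ k, Measurable (w k))
    {x₀ : Ω → X} (hx₀ : Measurable x₀) (hi : IndepFun x₀ (fun ω k => w k ω) Pr)
    (π : Policy X U) :
    cost Pr f ℓ γ x₀ w π = ∫⁻ ω, value Pr f ℓ γ w π (x₀ ω) ∂Pr := by
  have hm : Measurable fun ω k => w k ω := measurable_pi_lambda _ hw
  have hp := measurable_pathCost (γ := γ) hf hℓ π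
  have h1 := (indepFun_iff_map_prod_eq_prod_map_map hx₀.aemeasurable hm.aemeasurable).mp hi
  have := Measure.isProbabilityMeasure_map (μ := Pr) hm.aemeasurable
  simp only [cost, value]
  rw [← lintegral_map hp (hx₀.prodMk hm), h1, lintegral_prod _ hp.aemeasurable,
    lintegral_map hp.lintegral_prod_right' hx₀]
  refine lintegral_congr fun ω => ?_
  exact lintegral_map (hp.comp measurable_prodMk_left) hm

end ControlledSystems

end DiscountedLQR
namespace DiscountedLQR

open Filter Topology

/-! ### Traces of products of positive semidefinite matrices. -/

section Trace

variable {n : ℕ}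

/-- By cyclicity the trace is that of `S^{1/2} P S^{1/2}`. -/
theorem trace_mul_nonneg {P S : Matrix (Fin n) (Fin n) ℝ} (hP : P.PosSemidef)
    (hS : S.PosSemidef) : 0 ≤ (P * S).trace := by
  have hs : (CFC.sqrt S).PosSemidef := Matrix.nonneg_iff_posSemidef.mp (CFC.sqrt_nonneg S)
  have h1 := (hP.mul_mul_conjTranspose_same (CFC.sqrt S)).trace_nonneg
  rwa [hs.isHermitian.eq, Matrix.mul_assoc, Matrix.trace_mul_comm, Matrix.mul_assoc,
    CFC.sqrt_mul_sqrt_self S hS.nonneg] at h1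

theorem trace_mul_mono {P P' S : Matrix (Fin n) (Fin n) ℝ} (hP : P.PosSemidef)
    (hP' : P'.PosSemidef) (hS : S.PosSemidef) (h : ∀ x, quadForm P x ≤ quadForm P' x) :
    (P * S).trace ≤ (P' * S).trace := by
  have h1 : (P' - P).PosSemidef := posSemidef_of_quadForm
    (by rw [Matrix.transpose_sub, transpose_eq_of_posSemidef hP, transpose_eq_of_posSemidef hP'])
    fun x => by rw [quadForm_sub_matrix]; exact sub_nonneg.mpr (h x)
  have h2 := trace_mul_nonneg h1 hS
  rwa [Matrix.sub_mul, Matrix.trace_sub, sub_nonneg] at h2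

end Trace

/-! ### Expectation of a quadratic form. -/

section Expectation

variable {Ω : Type*} [MeasurableSpace Ω] {Pr : Measure Ω} [IsProbabilityMeasure Pr] {n : ℕ}

/-- The expectation of a quadratic function of a centred square-integrable perturbation. -/
theorem lintegral_quadForm_add {v : Ω → Fin n → ℝ} (hv : MemLp v 2 Pr)
    (hmean : ∀ i, ∫ ω, v ω i ∂Pr = 0) {S : Matrix (Fin n) (Fin n) ℝ}
    (hcov : ∀ i j, ∫ ω, v ω i * v ω j ∂Pr = S i j) {P : Matrix (Fin n) (Fin n) ℝ}
    (hP : P.PosSemidef) {c : ℝ} (hc : 0 ≤ c) (y : Fin n → ℝ) :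
    ∫⁻ ω, ENNReal.ofReal (1 / 2 * (quadForm P (y + v ω) + c)) ∂Pr =
      ENNReal.ofReal (1 / 2 * (quadForm P y + (P * S).trace + c)) := by
  have hvi (i : Fin n) : MemLp (fun ω => v ω i) 2 Pr := hv.eval i
  have h1 (i : Fin n) : Integrable (fun ω => v ω i) Pr := (hvi i).integrable one_le_two
  have h2 (i j : Fin n) : Integrable (fun ω => v ω i * v ω j) Pr :=
    (hvi i).integrable_mul (hvi j)
  have hlin : Integrable (fun ω => v ω ⬝ᵥ P *ᵥ y) Pr :=
    integrable_finsetSum _ fun i _ => (h1 i).mul_const _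
  have hlin0 : ∫ ω, v ω ⬝ᵥ P *ᵥ y ∂Pr = 0 := by
    simp only [dotProduct]
    rw [integral_finsetSum _ fun i _ => (h1 i).mul_const _]
    simp [integral_mul_const, hmean]
  have hexp (ω : Ω) : quadForm P (v ω) = ∑ i, ∑ j, P i j * (v ω i * v ω j) := by
    simp only [quadForm, dotProduct, Matrix.mulVec, Finset.mul_sum]
    exact Finset.sum_congr rfl fun i _ => Finset.sum_congr rfl fun j _ => by ring
  have hquad : Integrable (fun ω => quadForm P (v ω)) Pr := by
    simp_rw [hexp]
    exact integrable_finsetSum _ fun i _ => integrable_finsetSum _ fun j _ =>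
      (h2 i j).const_mul _
  have hquad0 : ∫ ω, quadForm P (v ω) ∂Pr = (P * S).trace := by
    simp_rw [hexp]
    refine (integral_finsetSum _ fun i _ => integrable_finsetSum _ fun j _ =>
      (h2 i j).const_mul _).trans ?_
    simp only [Matrix.trace, Matrix.diag_apply, Matrix.mul_apply]
    refine Finset.sum_congr rfl fun i _ => ?_
    refine (integral_finsetSum _ fun j _ => (h2 i j).const_mul _).trans ?_
    refine Finset.sum_congr rfl fun j _ => ?_
    rw [integral_const_mul, ← hcov j i]
    simp_rw [mul_comm]
  have hall : (fun ω => 1 / 2 * (quadForm P (y + v ω) + c)) = fun ω =>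
      1 / 2 * ((quadForm P y + c) + 2 * (v ω ⬝ᵥ P *ᵥ y) + quadForm P (v ω)) := by
    funext ω
    rw [quadForm_add P (transpose_eq_of_posSemidef hP)]
    ring
  have hint1 : Integrable (fun ω => (quadForm P y + c) + 2 * (v ω ⬝ᵥ P *ᵥ y)) Pr :=
    (integrable_const _).add (hlin.const_mul 2)
  have hint : Integrable (fun ω => 1 / 2 * (quadForm P (y + v ω) + c)) Pr := by
    rw [hall]
    exact (hint1.add hquad).const_mul _
  rw [← ofReal_integral_eq_lintegral_ofReal hint (ae_of_all _ fun ω => by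
    have := quadForm_nonneg hP (y + v ω)
    simp only [Pi.zero_apply]
    positivity)]
  congr 1
  rw [hall, integral_const_mul, integral_add hint1 hquad,
    integral_add (integrable_const _) (hlin.const_mul 2), integral_const_mul, hlin0, hquad0]
  simp
  ring

end Expectation

/-! ### Value bounds for the linear-quadratic problem. -/

section LinearQuadratic

variable {n m : ℕ} {A : Matrix (Fin n) (Fin n) ℝ} {B : Matrix (Fin n) (Fin m) ℝ}
  {Q : Matrix (Fin n) (Fin n) ℝ} {R : Matrix (Fin m) (Fin m) ℝ} {γ : ℝ}

theorem measurable_linearDynamics :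
    Measurable fun p : (Fin n → ℝ) × (Fin m → ℝ) × (Fin n → ℝ) =>
      linearDynamics A B p.1 p.2.1 p.2.2 := by
  unfold linearDynamics
  exact Continuous.measurable (by fun_prop)

theorem measurable_quadraticCost :
    Measurable fun p : (Fin n → ℝ) × (Fin m → ℝ) => quadraticCost Q R p.1 p.2 := by
  unfold quadraticCost
  exact Continuous.measurable (by fun_prop)

theorem quadraticCost_nonneg (hQ : Q.PosSemidef) (hR : R.PosDef) (x : Fin n → ℝ)
    (u : Fin m → ℝ) : 0 ≤ quadraticCost Q R x u := by
  have h1 := quadForm_nonneg hQ x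
  have h2 := quadForm_nonneg hR.posSemidef u
  simp only [quadraticCost]
  simp only [quadForm] at h1 h2
  positivity

variable (A B Q R γ) in
/-- The constant term of the `N`-step value function. -/
noncomputable def iterConst (S : Matrix (Fin n) (Fin n) ℝ) : ℕ → ℝ
  | 0 => 0
  | N + 1 => γ * ((riccatiIter A B Q R γ N * S).trace + iterConst S N)

theorem iterConst_nonneg (hQ : Q.PosSemidef) (hR : R.PosDef) (hγ : 0 ≤ γ)
    {S : Matrix (Fin n) (Fin n) ℝ} (hS : S.PosSemidef) (N : ℕ) :
    0 ≤ iterConst A B Q R γ S N := by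
  induction N with
  | zero => exact le_rfl
  | succ N ih =>
    exact mul_nonneg hγ (add_nonneg
      (trace_mul_nonneg (posSemidef_riccatiIter hQ hR hγ N) hS) ih)

/-- The constants increase and are bounded by the claimed limit. Their limit satisfies `l = γ(tr(PS)
+ l)`, which determines it. -/
theorem tendsto_iterConst (hQ : Q.PosSemidef) (hR : R.PosDef) (hγ : γ ∈ Set.Ioo (0 : ℝ) 1)
    {S : Matrix (Fin n) (Fin n) ℝ} (hS : S.PosSemidef) {P : Matrix (Fin n) (Fin n) ℝ}
    (hP : P.PosSemidef) (hlim : Tendsto (riccatiIter A B Q R γ) atTop (𝓝 P)) :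
    Tendsto (iterConst A B Q R γ S) atTop (𝓝 (γ / (1 - γ) * (P * S).trace)) := by
  have hpsd := posSemidef_riccatiIter (A := A) (B := B) hQ hR hγ.1.le
  have hmonoQ := monotone_quadForm_riccatiIter (A := A) (B := B) hQ hR hγ.1.le
  have h1γ : 0 < 1 - γ := sub_pos.mpr hγ.2
  have htr : Tendsto (fun N => (riccatiIter A B Q R γ N * S).trace) atTop
      (𝓝 (P * S).trace) := by
    have hc : Continuous fun M : Matrix (Fin n) (Fin n) ℝ => (M * S).trace := by fun_prop
    exact (hc.tendsto P).comp hlim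
  have hle (N : ℕ) : (riccatiIter A B Q R γ N * S).trace ≤ (P * S).trace :=
    trace_mul_mono (hpsd N) hP hS fun x => (hmonoQ x).ge_of_tendsto
      (((continuous_quadForm_left x).tendsto P).comp hlim) N
  have hbdd (N : ℕ) : iterConst A B Q R γ S N ≤ γ / (1 - γ) * (P * S).trace := by
    induction N with
    | zero =>
      have := trace_mul_nonneg hP hS
      have := hγ.1.le
      exact mul_nonneg (div_nonneg this h1γ.le) ‹_›
    | succ N ih =>
      calc γ * ((riccatiIter A B Q R γ N * S).trace + iterConst A B Q R γ S N)
          ≤ γ * ((P * S).trace + γ / (1 - γ) * (P * S).trace) :=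
            mul_le_mul_of_nonneg_left (add_le_add (hle N) ih) hγ.1.le
        _ = γ / (1 - γ) * (P * S).trace := by field_simp; ring
  have hmono : Monotone (iterConst A B Q R γ S) := by
    refine monotone_nat_of_le_succ fun N => ?_
    induction N with
    | zero => exact iterConst_nonneg hQ hR hγ.1.le hS 1
    | succ N ih =>
      exact mul_le_mul_of_nonneg_left (add_le_add
        (trace_mul_mono (hpsd N) (hpsd (N + 1)) hS fun x => hmonoQ x N.le_succ) ih) hγ.1.le
  obtain ⟨l, hl⟩ : ∃ l, Tendsto (iterConst A B Q R γ S) atTop (𝓝 l) :=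
    ⟨_, tendsto_atTop_ciSup hmono ⟨_, by rintro _ ⟨N, rfl⟩; exact hbdd N⟩⟩
  have h1 : l = γ * ((P * S).trace + l) :=
    tendsto_nhds_unique ((tendsto_add_atTop_iff_nat 1).mpr hl) ((htr.add hl).const_mul γ)
  have h2 : l = γ / (1 - γ) * (P * S).trace := by
    field_simp
    linarith
  rwa [← h2]

variable {Ω : Type*} [MeasurableSpace Ω] {Pr : Measure Ω} [IsProbabilityMeasure Pr]
  {w : ℕ → Ω → Fin n → ℝ} {S : Matrix (Fin n) (Fin n) ℝ}

/-- The one-step cost with a quadratic continuation value. -/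
theorem quadratic_bellman_step (hw_L2 : MemLp (w 0) 2 Pr)
    (hw_mean : ∀ i, ∫ ω, w 0 ω i ∂Pr = 0) (hw_cov : ∀ i j, ∫ ω, w 0 ω i * w 0 ω j ∂Pr = S i j)
    (hQ : Q.PosSemidef) (hR : R.PosDef) (hγ : 0 ≤ γ) (hS : S.PosSemidef)
    {P : Matrix (Fin n) (Fin n) ℝ} (hP : P.PosSemidef) {c : ℝ} (hc : 0 ≤ c)
    (x : Fin n → ℝ) (u : Fin m → ℝ) :
    ENNReal.ofReal (quadraticCost Q R x u) + ENNReal.ofReal γ *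
        ∫⁻ ω, ENNReal.ofReal (1 / 2 * (quadForm P (linearDynamics A B x u (w 0 ω)) + c)) ∂Pr =
      ENNReal.ofReal (1 / 2 * (quadForm (riccatiMap A B Q R γ P) x +
        quadForm (R + γ • (Bᵀ * P * B)) (u - optimalGain A B R γ P *ᵥ x) +
        γ * ((P * S).trace + c))) := by
  simp only [linearDynamics]
  have h1 := quadForm_nonneg hP (A *ᵥ x + B *ᵥ u)
  have h2 := trace_mul_nonneg hP hS
  rw [lintegral_quadForm_add hw_L2 hw_mean hw_cov hP hc, ← ENNReal.ofReal_mul hγ,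
    ← ENNReal.ofReal_add (quadraticCost_nonneg hQ hR x u) (by positivity)]
  congr 1
  rw [← quadForm_step hR hγ hP, quadraticCost]
  simp only [quadForm]
  ring

/-- Backward induction with zero terminal cost. The policy varies in the induction because the
remaining steps follow `π.shift`; each step discards a nonnegative square. -/
theorem ofReal_le_partialValue (hw : ∀ k, Measurable (w k)) (hi : iIndepFun w Pr)
    (hid : ∀ k, IdentDistrib (w k) (w 0) Pr Pr) (hw_L2 : MemLp (w 0) 2 Pr)
    (hw_mean : ∀ i, ∫ ω, w 0 ω i ∂Pr = 0) (hw_cov : ∀ i j, ∫ ω, w 0 ω i * w 0 ω j ∂Pr = S i j)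
    (hQ : Q.PosSemidef) (hR : R.PosDef) (hγ : 0 ≤ γ) (hS : S.PosSemidef) (N : ℕ)
    (π : Policy (Fin n → ℝ) (Fin m → ℝ)) (x : Fin n → ℝ) :
    ENNReal.ofReal (1 / 2 *
        (quadForm (riccatiIter A B Q R γ N) x + iterConst A B Q R γ S N)) ≤
      partialValue Pr (linearDynamics A B) (quadraticCost Q R) γ w π N x := by
  induction N generalizing π x with
  | zero => simp [riccatiIter, iterConst, quadForm]
  | succ N ih =>
    have hpsd := posSemidef_riccatiIter (A := A) (B := B) hQ hR hγ N
    rw [partialValue_succ measurable_linearDynamics measurable_quadraticCost hγ hw hi hid]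
    refine le_trans ?_ (add_le_add_right (mul_le_mul_right
      (lintegral_mono fun ω => ih π.shift _) _) _)
    rw [quadratic_bellman_step hw_L2 hw_mean hw_cov hQ hR hγ hS hpsd
      (iterConst_nonneg hQ hR hγ hS N)]
    refine ENNReal.ofReal_le_ofReal ?_
    have h := quadForm_nonneg (posDef_add_smul (B := B) hR hγ hpsd).posSemidef
      (π.act 0 x - optimalGain A B R γ (riccatiIter A B Q R γ N) *ᵥ x)
    simp only [riccatiIter, iterConst]
    linarith

theorem quadraticValue_eq (P : Matrix (Fin n) (Fin n) ℝ) (x : Fin n → ℝ) :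
    quadraticValue γ P S x = 1 / 2 * (quadForm P x + γ / (1 - γ) * (P * S).trace) := rfl

/-- The Bellman operator at the quadratic value function of a solution of the Riccati equation. -/
theorem quadraticValue_step (hw_L2 : MemLp (w 0) 2 Pr)
    (hw_mean : ∀ i, ∫ ω, w 0 ω i ∂Pr = 0) (hw_cov : ∀ i j, ∫ ω, w 0 ω i * w 0 ω j ∂Pr = S i j)
    (hQ : Q.PosSemidef) (hR : R.PosDef) (hγ : γ ∈ Set.Ioo (0 : ℝ) 1) (hS : S.PosSemidef)
    {P : Matrix (Fin n) (Fin n) ℝ} (hP : P.PosSemidef) (hfix : riccatiMap A B Q R γ P = P)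
    (x : Fin n → ℝ) (u : Fin m → ℝ) :
    ENNReal.ofReal (quadraticCost Q R x u) + ENNReal.ofReal γ *
        ∫⁻ ω, ENNReal.ofReal (quadraticValue γ P S (linearDynamics A B x u (w 0 ω))) ∂Pr =
      ENNReal.ofReal (quadraticValue γ P S x + 1 / 2 *
        quadForm (R + γ • (Bᵀ * P * B)) (u - optimalGain A B R γ P *ᵥ x)) := by
  have h1γ : 0 < 1 - γ := sub_pos.mpr hγ.2
  simp only [quadraticValue_eq]
  rw [quadratic_bellman_step hw_L2 hw_mean hw_cov hQ hR hγ.1.le hS hP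
    (mul_nonneg (div_nonneg hγ.1.le h1γ.le) (trace_mul_nonneg hP hS)), hfix]
  congr 1
  field_simp
  ring

theorem quadraticValue_nonneg (hγ : γ ∈ Set.Ioo (0 : ℝ) 1) (hS : S.PosSemidef)
    {P : Matrix (Fin n) (Fin n) ℝ} (hP : P.PosSemidef) (x : Fin n → ℝ) :
    0 ≤ quadraticValue γ P S x := by
  have h1γ : 0 ≤ 1 - γ := sub_nonneg.mpr hγ.2.le
  have h1 := quadForm_nonneg hP x
  have h2 := trace_mul_nonneg hP hS
  have h3 := hγ.1.le
  rw [quadraticValue_eq]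
  positivity

/-- Bounding every finite horizon suffices. The induction starts from cost `0`, below the
nonnegative quadratic value, and the square vanishes along `u = Fx`, so the bound reproduces itself.
-/
theorem value_linearPolicy_le (hw : ∀ k, Measurable (w k)) (hi : iIndepFun w Pr)
    (hid : ∀ k, IdentDistrib (w k) (w 0) Pr Pr) (hw_L2 : MemLp (w 0) 2 Pr)
    (hw_mean : ∀ i, ∫ ω, w 0 ω i ∂Pr = 0) (hw_cov : ∀ i j, ∫ ω, w 0 ω i * w 0 ω j ∂Pr = S i j)
    (hQ : Q.PosSemidef) (hR : R.PosDef) (hγ : γ ∈ Set.Ioo (0 : ℝ) 1) (hS : S.PosSemidef)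
    {P : Matrix (Fin n) (Fin n) ℝ} (hP : P.PosSemidef) (hfix : riccatiMap A B Q R γ P = P)
    (x : Fin n → ℝ) :
    value Pr (linearDynamics A B) (quadraticCost Q R) γ w
        (linearPolicy (optimalGain A B R γ P)) x ≤ ENNReal.ofReal (quadraticValue γ P S x) := by
  rw [value_eq_iSup measurable_linearDynamics measurable_quadraticCost hw]
  refine iSup_le fun N => ?_
  induction N generalizing x with
  | zero => simp [partialValue, partialCost]
  | succ N ih =>
    rw [partialValue_succ measurable_linearDynamics measurable_quadraticCost hγ.1.le hw hi hid]
    refine (add_le_add_right (mul_le_mul_right (lintegral_mono fun ω => ih _) _) _).trans ?_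
    rw [quadraticValue_step hw_L2 hw_mean hw_cov hQ hR hγ hS hP hfix]
    simp [linearPolicy, Policy.stationary, quadForm_zero_right]

end LinearQuadratic

end DiscountedLQR

/-! ### The main theorem. -/

theorem mainTheorem9 {Ω : Type*} [MeasurableSpace Ω] (Pr : Measure Ω) [IsProbabilityMeasure Pr]
    (n m : ℕ)
    (A : Matrix (Fin n) (Fin n) ℝ) (B : Matrix (Fin n) (Fin m) ℝ)
    (Q : Matrix (Fin n) (Fin n) ℝ) (R : Matrix (Fin m) (Fin m) ℝ)
    (hQ : Q.PosSemidef) (hR : R.PosDef)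
    (γ : ℝ) (hγ : γ ∈ Set.Ioo (0 : ℝ) 1)
    -- the initial state
    (x₀ : Ω → Fin n → ℝ) (hx₀_meas : Measurable x₀) (hx₀_L2 : MemLp x₀ 2 Pr)
    (μ₀ : Fin n → ℝ) (hx₀_mean : ∀ i, ∫ ω, x₀ ω i ∂Pr = μ₀ i)
    (S₀ : Matrix (Fin n) (Fin n) ℝ) (hS₀ : S₀.PosSemidef)
    (hx₀_cov : ∀ i j, ∫ ω, (x₀ ω i - μ₀ i) * (x₀ ω j - μ₀ j) ∂Pr = S₀ i j)
    -- the disturbances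
    (w : ℕ → Ω → Fin n → ℝ) (hw_meas : ∀ k, Measurable (w k)) (hw_L2 : ∀ k, MemLp (w k) 2 Pr)
    (hw_indep : iIndepFun w Pr) (hw_ident : ∀ k, IdentDistrib (w k) (w 0) Pr Pr)
    (hw_mean : ∀ k i, ∫ ω, w k ω i ∂Pr = 0)
    (Sw : Matrix (Fin n) (Fin n) ℝ) (hSw : Sw.PosSemidef)
    (hw_cov : ∀ k i j, ∫ ω, w k ω i * w k ω j ∂Pr = Sw i j)
    (hx₀_indep : IndepFun x₀ (fun ω k => w k ω) Pr)
    (hstab : IsStabilizable A B) (hdet : IsDetectable A (CFC.sqrt Q)) :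
    -- the optimal value function satisfies the Bellman equation
    SatisfiesBellman Pr (linearDynamics A B) (quadraticCost Q R) γ w
      (optimalValue Pr (linearDynamics A B) (quadraticCost Q R) γ w) ∧
    -- the Riccati equation has a unique positive semidefinite solution `P`, and for it:
    (∃! P : Matrix (Fin n) (Fin n) ℝ, P.PosSemidef ∧ SolvesRiccati A B Q R γ P) ∧
    ∀ P : Matrix (Fin n) (Fin n) ℝ, P.PosSemidef → SolvesRiccati A B Q R γ P →
      -- the optimal value function is the quadratic one
      (∀ x, optimalValue Pr (linearDynamics A B) (quadraticCost Q R) γ w x =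
        ENNReal.ofReal (quadraticValue γ P Sw x)) ∧
      -- `J(π_F) = inf_π J(π) = E[V*(x₀)]`
      cost Pr (linearDynamics A B) (quadraticCost Q R) γ x₀ w
          (linearPolicy (optimalGain A B R γ P)) =
        (⨅ π, cost Pr (linearDynamics A B) (quadraticCost Q R) γ x₀ w π) ∧
      (⨅ π, cost Pr (linearDynamics A B) (quadraticCost Q R) γ x₀ w π) =
        ∫⁻ ω, optimalValue Pr (linearDynamics A B) (quadraticCost Q R) γ w (x₀ ω) ∂Pr ∧
      -- `(π_F, π_F, …)` attains `V*` at every state, and no other time-invariant policy does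
      (∀ (φ : (Fin n → ℝ) → (Fin m → ℝ)) (hφ : Measurable φ),
        (∀ x, value Pr (linearDynamics A B) (quadraticCost Q R) γ w (Policy.stationary φ hφ) x =
          optimalValue Pr (linearDynamics A B) (quadraticCost Q R) γ w x) ↔
        φ = fun x => optimalGain A B R γ P *ᵥ x) := by
  have hw0 := hw_L2 0
  have hm0 := hw_mean 0
  have hc0 := hw_cov 0
  have hf := measurable_linearDynamics (A := A) (B := B)
  have hℓ := measurable_quadraticCost (Q := Q) (R := R)
  obtain ⟨P₀, hP₀, hfix₀, hlim⟩ := exists_tendsto_riccatiIter hQ hR hγ hstab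
  have huniq (P : Matrix (Fin n) (Fin n) ℝ) (hP : P.PosSemidef)
      (h : SolvesRiccati A B Q R γ P) : P = P₀ :=
    riccati_unique hQ hR hγ hdet hP hP₀ ((solvesRiccati_iff hR hγ.1 hP).mp h) hfix₀
  have hlower (π : Policy (Fin n → ℝ) (Fin m → ℝ)) (x : Fin n → ℝ) :
      ENNReal.ofReal (quadraticValue γ P₀ Sw x) ≤
        value Pr (linearDynamics A B) (quadraticCost Q R) γ w π x := by
    have h1 := (((((continuous_quadForm_left x).tendsto P₀).comp hlim).add
      (tendsto_iterConst hQ hR hγ hSw hP₀ hlim)).const_mul (1 / 2 : ℝ))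
    refine le_of_tendsto' (ENNReal.tendsto_ofReal h1) fun N => ?_
    rw [value_eq_iSup hf hℓ hw_meas]
    exact (ofReal_le_partialValue hw_meas hw_indep hw_ident hw0 hm0 hc0 hQ hR hγ.1.le hSw N
      π x).trans (le_iSup (fun N => partialValue Pr (linearDynamics A B) (quadraticCost Q R) γ w
        π N x) N)
  have hupper := value_linearPolicy_le hw_meas hw_indep hw_ident hw0 hm0 hc0 hQ hR hγ hSw hP₀
    hfix₀
  have hopt (x : Fin n → ℝ) : optimalValue Pr (linearDynamics A B) (quadraticCost Q R) γ w x =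
      ENNReal.ofReal (quadraticValue γ P₀ Sw x) :=
    le_antisymm ((iInf_le _ _).trans (hupper x)) (le_iInf fun π => hlower π x)
  have hF (x : Fin n → ℝ) : value Pr (linearDynamics A B) (quadraticCost Q R) γ w
      (linearPolicy (optimalGain A B R γ P₀)) x =
      optimalValue Pr (linearDynamics A B) (quadraticCost Q R) γ w x :=
    le_antisymm ((hupper x).trans (hopt x).ge) (iInf_le _ _)
  have hstep := quadraticValue_step (A := A) (B := B) hw0 hm0 hc0 hQ hR hγ hSw hP₀ hfix₀
  have hM := posDef_add_smul (B := B) hR hγ.1.le hP₀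
  refine ⟨fun x => ?_, ⟨P₀, ⟨hP₀, (solvesRiccati_iff hR hγ.1 hP₀).mpr hfix₀⟩,
    fun P h => huniq P h.1 h.2⟩, fun P hP hsol => ?_⟩
  -- The bracket in the Bellman equation is now `V*(x)` plus a nonnegative square that is zero at `u
  -- = Fx`.
  · simp_rw [hopt, hstep]
    refine le_antisymm (le_iInf fun u => ENNReal.ofReal_le_ofReal ?_)
      (iInf_le_of_le (optimalGain A B R γ P₀ *ᵥ x) ?_)
    · have := quadForm_nonneg hM.posSemidef (u - optimalGain A B R γ P₀ *ᵥ x)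
      linarith
    · simp [quadForm_zero_right]
  · obtain rfl := huniq P hP hsol
    have hcost := cost_eq_lintegral_value (γ := γ) hf hℓ hw_meas hx₀_meas hx₀_indep
    have hJF : cost Pr (linearDynamics A B) (quadraticCost Q R) γ x₀ w
        (linearPolicy (optimalGain A B R γ P)) =
        ∫⁻ ω, optimalValue Pr (linearDynamics A B) (quadraticCost Q R) γ w (x₀ ω) ∂Pr := by
      rw [hcost]
      exact lintegral_congr fun ω => hF _
    have hinf : (⨅ π, cost Pr (linearDynamics A B) (quadraticCost Q R) γ x₀ w π) =
        ∫⁻ ω, optimalValue Pr (linearDynamics A B) (quadraticCost Q R) γ w (x₀ ω) ∂Pr := by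
      -- Infimum and expectation commute because `π_F` attains the pointwise infimum at every state
      -- simultaneously.
      refine le_antisymm ((iInf_le _ _).trans hJF.le) (le_iInf fun π => ?_)
      rw [hcost]
      exact lintegral_mono fun ω => iInf_le _ _
    refine ⟨hopt, hJF.trans hinf.symm, hinf, fun φ hφ => ⟨fun h => funext fun x => ?_, ?_⟩⟩
    · have h1 := h x
      -- With `V^φ = V*` on both sides of the one-step equation for `φ`, the square of `φ x - Fx`
      -- must be zero; finiteness of `V*` permits the cancellation.
      rw [value_eq_add hf hℓ hγ.1.le hw_meas hw_indep hw_ident, Policy.shift_stationary] at h1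
      simp_rw [h, hopt, hstep] at h1
      have hq := quadForm_nonneg hM.posSemidef (φ x - optimalGain A B R γ P *ᵥ x)
      have hV := quadraticValue_nonneg hγ hSw hP x
      rw [ENNReal.ofReal_eq_ofReal_iff (by
        simp only [Policy.stationary]; positivity) hV] at h1
      simp only [Policy.stationary] at h1
      exact sub_eq_zero.mp (quadForm_eq_zero hM (by linarith))
    · rintro rfl
      exact hF
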